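/- Let $p$ be a prime, let $\overline{\mathbf Q}_p$ be an algebraic closure of $\mathbf Q_p$ with the extended $p$-adic absolute value and valuation $v_p$, and let $\overline{\mathbf F}_p$ be its residue field. For $a\in\overline{\mathbf F}_p$ let $[a]\in\overline{\mathbf Q}_p$ be its Teichmüller representative, i.e. the unique element that reduces to $a$ and satisfies $[a]^{p^k}=[a]$ for some $k\ge 1$. Fix any choice of rational powers of $p$ in $\overline{\mathbf Q}_p$, i.e. a map $t\mapsto p^t$ from $\mathbf Q$ to $\overline{\mathbf Q}_p$ with $p^{s+t}=p^sp^t$ for all $s,t\in\mathbf Q$ and with value $p$ at $t=1$. Let $x\in\overline{\mathbf Q}_p$ with $v_p(x)\ge 0$ (where $v_p(0)=\infty$), and suppose that the degree $n$ of the minimal polynomial of $x$ over $\mathbf Q_p$ is not divisible by $p$. Then there are $N\in\{0,1,2,\dots\}\cup\{\infty\}$, a strictly increasing sequence of rational numbers $t_i=u_i/v_i$ $(0\le i<N)$ in lowest terms with $v_i\ge 1$, and nonzero elements $\varepsilon_i\in\overline{\mathbf F}_p$ $(0\le i<N)$ such that $$x=\sum_{0\le i<N}[\varepsilon_i]\,p^{t_i},$$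 where the sum, if infinite, is the $p$-adic limit of its partial sums. Moreover: (i) $\lim_{m\to\infty}\operatorname{lcm}\{v_i : i<m,\ i<N\}=e$, where $e$ is the ramification index of $\mathbf Q_p(x)$ over $\mathbf Q_p$, that is, the index of the value group of $\mathbf Q_p$ in the value group of $\mathbf Q_p(x)$ (the lcm of the empty set is $1$); and $[\varepsilon_i]^{v_i}\in\mathbf Q_p(x)$ for every $i<N$. (ii) All the $\varepsilon_i$ lie in one finite extension of $\mathbf F_p$ inside $\overline{\mathbf F}_p$. (iii) The expansion is unique: if $x=\sum_{0\le i<N'}[\varepsilon'_i]\,p^{t'_i}$ is any expansion with $N'\in\{0,1,2,\dots\}\cup\{\infty\}$, $(t'_i)$ a strictly increasing sequence of rational numbers and $\varepsilon'_i\in\overline{\mathbf F}_p$ all nonzero, then $N'=N$, and $t'_i=t_i$ and $\varepsilon'_i=\varepsilon_i$ for all $i<N$. -/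

import Mathlib

open Filter Topology Polynomial
open scoped NNReal IntermediateField

namespace PadicExpansion

section

variable (p : ℕ) [Fact p.Prime]

/-- The valuation ring `{z : |z| ≤ 1}` of the algebraic closure `PadicAlgCl p` of `ℚ_[p]`. -/
noncomputable abbrev IntRing : ValuationSubring (PadicAlgCl p) :=
  (Valued.v : Valuation (PadicAlgCl p) ℝ≥0).valuationSubring

/-- The residue field of the algebraic closure of `ℚ_[p]`. It is an algebraic closure of the field
with `p` elements, and the digits of an expansion are taken in it. -/
noncomputable abbrev Digit : Type := IsLocalRing.ResidueField (IntRing p)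

/-- `z` is the Teichmüller representative of `a`: it reduces to `a` and it satisfies
`z ^ (p ^ k) = z` for some `k ≥ 1`, that is, `z` is `0` or a root of unity of order prime
to `p`. -/
def IsTeichmuller (a : Digit p) (z : IntRing p) : Prop :=
  IsLocalRing.residue (IntRing p) z = a ∧ ∃ k : ℕ, 1 ≤ k ∧ z ^ p ^ k = z

/-- The ramification index over `ℚ_[p]` of an algebraic extension `K` of `ℚ_[p]`: the index of the
value group of `ℚ_[p]` in the value group of `K`. -/
noncomputable def ramificationIndex (K : IntermediateField ℚ_[p] (PadicAlgCl p)) : ℕ :=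
  Subgroup.relIndex
    (((Units.map (Valued.v : Valuation (PadicAlgCl p) ℝ≥0).toMonoidHom).comp
      (Units.map (algebraMap ℚ_[p] (PadicAlgCl p)).toMonoidHom)).range)
    (((Units.map (Valued.v : Valuation (PadicAlgCl p) ℝ≥0).toMonoidHom).comp
      (Units.map (algebraMap K (PadicAlgCl p)).toMonoidHom)).range)

/-- `ω` is a choice of all the rational powers of `p` in `PadicAlgCl p`: it is a homomorphism from
`(ℚ, +)` to the multiplicative group with `ω 1 = p`; one writes `p ^ t` for `ω t`. -/
structure IsPowerSystem (ω : ℚ → PadicAlgCl p) : Prop where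
  map_one : ω 1 = (p : PadicAlgCl p)
  map_add : ∀ s t : ℚ, ω (s + t) = ω s * ω t

end

section

variable {p : ℕ} [Fact p.Prime]

theorem mem_intRing {z : PadicAlgCl p} : z ∈ IntRing p ↔ ‖z‖ ≤ 1 := Iff.rfl

theorem residue_eq_zero {z : IntRing p} :
    IsLocalRing.residue (IntRing p) z = 0 ↔ ‖(z : PadicAlgCl p)‖ < 1 := by
  rw [IsLocalRing.residue_eq_zero_iff, IsLocalRing.mem_maximalIdeal, mem_nonunits_iff,
    ← not_iff_not, not_not, not_lt]
  have h := (Valuation.integer.integers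
    (Valued.v : Valuation (PadicAlgCl p) ℝ≥0)).isUnit_iff_valuation_eq_one (x := z)
  refine Iff.trans h ?_
  change ‖(z : PadicAlgCl p)‖₊ = 1 ↔ _
  rw [← NNReal.coe_inj, coe_nnnorm, NNReal.coe_one]
  exact ⟨fun h => h.ge, fun h => le_antisymm (mem_intRing.1 z.2) h⟩

theorem digit_natCast_p : ((p : ℕ) : Digit p) = 0 := by
  have hp : p.Prime := Fact.out
  have h : IsLocalRing.residue (IntRing p) (p : IntRing p) = 0 := by
    rw [residue_eq_zero]
    have h2 : ‖((p : ℚ_[p]) : PadicAlgCl p)‖ < 1 := by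
      rw [PadicAlgCl.norm_extends]
      exact Padic.norm_p_lt_one
    simpa using h2
  simpa using h

/-- Every element of the residue field is fixed by a power of Frobenius. -/
theorem digit_pow_eq (a : Digit p) : ∃ k : ℕ, 1 ≤ k ∧ a ^ p ^ k = a := by
  have hp : p.Prime := Fact.out
  obtain ⟨y, rfl⟩ := IsLocalRing.residue_surjective a
  set a := IsLocalRing.residue (IntRing p) y with ha
  have hint : IsIntegral ℚ_[p] (y : PadicAlgCl p) := Algebra.IsIntegral.isIntegral _
  have hco : ∀ n, ‖(minpoly ℚ_[p] (y : PadicAlgCl p)).coeff n‖ ≤ 1 :=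
    (spectralValue_le_one_iff (minpoly.monic hint)).1 (mem_intRing.1 y.2)
  have hl : minpoly ℚ_[p] (y : PadicAlgCl p) ∈ lifts (PadicInt.Coe.ringHom (p := p)) := by
    rw [lifts_iff_coeff_lifts]
    exact fun n => ⟨⟨_, hco n⟩, rfl⟩
  obtain ⟨Q, hQ, -, hQm⟩ := lifts_and_natDegree_eq_and_monic hl (minpoly.monic hint)
  let φ₀ : ℤ_[p] →+* PadicAlgCl p :=
    (algebraMap ℚ_[p] (PadicAlgCl p)).comp PadicInt.Coe.ringHom
  have hφ₀ : ∀ r : ℤ_[p], ‖φ₀ r‖ = ‖r‖ := fun r => PadicAlgCl.norm_extends p (r : ℚ_[p])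
  let φ : ℤ_[p] →+* IntRing p := φ₀.codRestrict (IntRing p)
    (fun r => mem_intRing.2 ((hφ₀ r).trans_le r.norm_le_one))
  have hφ : ∀ r, ((φ r : IntRing p) : PadicAlgCl p) = φ₀ r := fun r => rfl
  have h1 : eval₂ φ y Q = 0 := by
    apply Subtype.ext
    have : (IntRing p).subtype (eval₂ φ y Q) = 0 := by
      rw [hom_eval₂]
      have h2 := minpoly.aeval ℚ_[p] (y : PadicAlgCl p)
      rw [← hQ, aeval_def, eval₂_map] at h2
      exact h2
    exact this
  have h2 : eval₂ ((IsLocalRing.residue (IntRing p)).comp φ) a Q = 0 := by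
    rw [ha, ← hom_eval₂, h1, map_zero]
  have hker : ∀ r ∈ RingHom.ker (PadicInt.toZMod (p := p)),
      ((IsLocalRing.residue (IntRing p)).comp φ) r = 0 := by
    intro r hr
    rw [PadicInt.ker_toZMod, IsLocalRing.mem_maximalIdeal, PadicInt.mem_nonunits] at hr
    rw [RingHom.comp_apply, residue_eq_zero, hφ, hφ₀]
    exact hr
  let ψ : ZMod p →+* Digit p :=
    RingHom.liftOfSurjective (PadicInt.toZMod (p := p)) (ZMod.ringHom_surjective _)
      ⟨(IsLocalRing.residue (IntRing p)).comp φ, hker⟩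
  have hψ : ψ.comp (PadicInt.toZMod (p := p)) = (IsLocalRing.residue (IntRing p)).comp φ :=
    RingHom.liftOfRightInverse_comp _ _ _ _
  let := ψ.toAlgebra
  have h3 : IsIntegral (ZMod p) a := by
    refine ⟨Q.map PadicInt.toZMod, hQm.map _, ?_⟩
    rw [eval₂_map]
    change eval₂ (ψ.comp _) a Q = 0
    rw [hψ, h2]
  have : FiniteDimensional (ZMod p) (IntermediateField.adjoin (ZMod p) {a}) :=
    IntermediateField.adjoin.finiteDimensional h3
  have : Finite (IntermediateField.adjoin (ZMod p) {a}) := Module.finite_of_finite (ZMod p)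
  let := Fintype.ofFinite (IntermediateField.adjoin (ZMod p) {a})
  have : CharP (IntermediateField.adjoin (ZMod p) {a}) p :=
    charP_of_injective_algebraMap (algebraMap (ZMod p) _).injective p
  obtain ⟨n, -, hn⟩ := FiniteField.card (IntermediateField.adjoin (ZMod p) {a}) p
  refine ⟨n, n.2, ?_⟩
  have h4 := FiniteField.pow_card
    (⟨a, IntermediateField.mem_adjoin_simple_self (ZMod p) a⟩ :
      IntermediateField.adjoin (ZMod p) {a})
  rw [hn] at h4
  exact congrArg Subtype.val h4

theorem existsUnique_teichmuller (a : Digit p) : ∃! z : IntRing p, IsTeichmuller p a z := by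
  have hp : p.Prime := Fact.out
  obtain ⟨y, rfl⟩ := IsLocalRing.residue_surjective a
  refine existsUnique_of_exists_of_unique ?_ ?_
  · obtain ⟨k, hk, hak⟩ := digit_pow_eq (IsLocalRing.residue (IntRing p) y)
    have hq : 1 < p ^ k := Nat.one_lt_pow (by omega) hp.one_lt
    have hm : (X ^ p ^ k - X : (PadicAlgCl p)[X]).Monic := by
      refine monic_X_pow_sub ?_
      rw [degree_X]
      exact_mod_cast hq
    have hs := (IsAlgClosed.splits (X ^ p ^ k - X : (PadicAlgCl p)[X])).eval_eq_prod_roots_of_monic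
      hm (y : PadicAlgCl p)
    have hlt : ‖(y : PadicAlgCl p) ^ p ^ k - y‖ < 1 := by
      have := (residue_eq_zero (z := y ^ p ^ k - y)).1 (by rw [map_sub, map_pow, hak, sub_self])
      simpa using this
    have hex : ∃ z ∈ (X ^ p ^ k - X : (PadicAlgCl p)[X]).roots, ‖(y : PadicAlgCl p) - z‖ < 1 := by
      by_contra! hcon
      have h1 : 1 ≤ ‖((X ^ p ^ k - X : (PadicAlgCl p)[X]).roots.map
          (fun z => (y : PadicAlgCl p) - z)).prod‖ := by
        generalize (X ^ p ^ k - X : (PadicAlgCl p)[X]).roots = s at hcon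
        induction s using Multiset.induction_on with
        | empty => simp
        | cons z s ih =>
          rw [Multiset.map_cons, Multiset.prod_cons, norm_mul]
          exact one_le_mul_of_one_le_of_one_le (hcon z (by simp))
            (ih fun w hw => hcon w (by simp [hw]))
      rw [← hs] at h1
      simp only [eval_sub, eval_pow, eval_X] at h1
      linarith
    obtain ⟨z, hz, hyz⟩ := hex
    have hzk : z ^ p ^ k = z := by
      have := isRoot_of_mem_roots hz
      simpa [sub_eq_zero] using this
    have hz1 : ‖z‖ ≤ 1 := by
      have := PadicAlgCl.isNonarchimedean p (z - y) y
      rw [sub_add_cancel, norm_sub_rev] at this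
      exact this.trans (max_le hyz.le (mem_intRing.1 y.2))
    refine ⟨⟨z, mem_intRing.2 hz1⟩, ?_, k, hk, Subtype.ext hzk⟩
    rw [← sub_eq_zero, ← map_sub, residue_eq_zero]
    simpa [norm_sub_rev] using hyz
  · rintro z w ⟨hz, k, hk, hzk⟩ ⟨hw, l, hl, hwl⟩
    have hz' : ∀ n : ℕ, z ^ p ^ (k * n) = z := by
      intro n
      induction n with
      | zero => simp
      | succ n ih => rw [Nat.mul_succ, pow_add, pow_mul, ih, hzk]
    have hw' : ∀ n : ℕ, w ^ p ^ (l * n) = w := by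
      intro n
      induction n with
      | zero => simp
      | succ n ih => rw [Nat.mul_succ, pow_add, pow_mul, ih, hwl]
    have h1 := hz' l
    have h2 := hw' k
    rw [mul_comm l k] at h2
    set q := p ^ (k * l) with hq
    have hg := (Commute.all z w).geom_sum₂_mul q
    rw [h1, h2] at hg
    have hr : IsLocalRing.residue (IntRing p)
        (∑ i ∈ Finset.range q, z ^ i * w ^ (q - 1 - i)) = 0 := by
      rw [map_sum]
      simp only [map_mul, map_pow, hz, hw]
      rw [geom_sum₂_self, hq, Nat.cast_pow, digit_natCast_p,
        zero_pow (by positivity), zero_mul]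
    set S := ∑ i ∈ Finset.range q, z ^ i * w ^ (q - 1 - i) with hS
    have hne : S - 1 ≠ 0 := by
      intro h0
      rw [sub_eq_zero.1 h0, _root_.map_one] at hr
      exact one_ne_zero hr
    have : (S - 1) * (z - w) = 0 := by rw [sub_mul, hg, one_mul, sub_self]
    exact sub_eq_zero.1 ((mul_eq_zero.1 this).resolve_left hne)

/-- The Teichmüller representative of a digit, as an element of the algebraic closure. -/
noncomputable def teichmuller (a : Digit p) : PadicAlgCl p :=
  ((existsUnique_teichmuller a).choose : IntRing p)

theorem exists_isPowerSystem : ∃ ω : ℚ → PadicAlgCl p, IsPowerSystem p ω := by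
  have hp : p.Prime := Fact.out
  have hp0 : (p : PadicAlgCl p) ≠ 0 := Nat.cast_ne_zero.2 hp.ne_zero
  let : DivisibleBy (Additive (PadicAlgCl p)ˣ) ℕ := by
    refine divisibleByOfSMulRightSurj _ _ fun {n} hn u => ?_
    obtain ⟨z, hz⟩ := IsAlgClosed.exists_pow_nat_eq ((u.toMul : (PadicAlgCl p)ˣ) : PadicAlgCl p)
      (Nat.pos_of_ne_zero hn)
    have hz0 : z ≠ 0 := by
      rintro rfl
      rw [zero_pow hn] at hz
      exact u.toMul.ne_zero hz.symm
    exact ⟨Additive.ofMul (Units.mk0 z hz0), Units.ext hz⟩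
  let : DivisibleBy (Additive (PadicAlgCl p)ˣ) ℤ := AddGroup.divisibleByIntOfDivisibleByNat _
  obtain ⟨h, hh⟩ := (Module.Baer.of_divisible
    (Additive (PadicAlgCl p)ˣ)).extension_property_addMonoidHom (Int.castAddHom ℚ)
      Int.cast_injective (zmultiplesHom _ (Additive.ofMul (Units.mk0 (p : PadicAlgCl p) hp0)))
  refine ⟨fun t => ((h t).toMul : (PadicAlgCl p)ˣ), ?_, fun s t => ?_⟩
  · have h1 := DFunLike.congr_fun hh 1
    simp only [AddMonoidHom.comp_apply, Int.coe_castAddHom, Int.cast_one, zmultiplesHom_apply,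
      one_smul] at h1
    rw [h1]
    rfl
  · rw [_root_.map_add]
    rfl

variable (p) in
/-- `x = ∑ ε_i p ^ t_i`, where `i` runs through the natural numbers `i < N` (so that the sum is
finite or infinite), the rational exponents `t_i` are strictly increasing, and the digits `ε_i` are
nonzero; a digit stands for its Teichmüller representative. The values of `t` and `ε` at the `i`
that are not `< N` are irrelevant. -/
structure IsExpansion (ω : ℚ → PadicAlgCl p) (x : PadicAlgCl p) (N : ℕ∞) (t : ℕ → ℚ)
    (ε : ℕ → Digit p) : Prop where
  strictMono : ∀ i j : ℕ, i < j → (j : ℕ∞) < N → t i < t j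
  digit_ne_zero : ∀ i : ℕ, (i : ℕ∞) < N → ε i ≠ 0
  tendsto_sum : Tendsto
    (fun m : ℕ => ∑ i ∈ Finset.range m with ((i : ℕ) : ℕ∞) < N, teichmuller (ε i) * ω (t i)) atTop (𝓝 x)

end

end PadicExpansion

/-!
Let `K = ℚ_p(x)`, with ramification index `e` prime to `p`, and let `L` be `K` with all
Teichmüller representatives adjoined. Their residues are algebraic and they are pairwise at
distance at least `1`, so interpolation at the conjugates of a representative `ζ` bounds the
coefficients of a polynomial of small degree by its value at `ζ`. Hence `L` has the same value
group `(1/e)ℤ` as `K`. For `t` in it, some `y ∈ K` has leading term `[a] p ^ t`. The quotient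
`[a] p ^ t / y` is near `1` and has a power of exponent prime to `p` in `L`, so by Galois theory
it lies in `L`, and so does `p ^ t`. Subtracting leading terms therefore never leaves `L`, and as
valuations in `L` are multiples of `1/e` the remainders tend to `0`.

An expansion is unique because its terms are forced to be the successive leading terms. Given `σ`
fixing `x`, applying `σ` to the expansion multiplies `p ^ t_i` by a root of unity of order dividing
`v_i`, which is a Teichmüller representative as `p` does not divide `v_i`; uniqueness then yields
`σ [ε_i] ^ v_i = [ε_i] ^ v_i`. Finally, if all `v_i` divide `l`, then `x` lies in `ℚ_p(p ^ (1/l))`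
with the Teichmüller representatives adjoined, whose ramification index is `l`, so `e ∣ l`.
-/

namespace PadicExpansion

/-! ### Polynomials over ultrametric fields -/

section Ultrametric

theorem norm_sub_le_max {E : Type*} [SeminormedAddCommGroup E] [IsUltrametricDist E] (x y : E) :
    ‖x - y‖ ≤ max ‖x‖ ‖y‖ := by
  rw [sub_eq_add_neg, ← norm_neg y]
  exact IsUltrametricDist.norm_add_le_max x (-y)

theorem norm_eq_of_norm_sub_lt {E : Type*} [SeminormedAddCommGroup E] [IsUltrametricDist E]
    {x y : E} (h : ‖x - y‖ < ‖y‖) : ‖x‖ = ‖y‖ := by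
  rw [← norm_neg y]
  refine IsUltrametricDist.norm_eq_of_add_norm_lt_max ?_
  rw [← sub_eq_add_neg, norm_neg]
  exact h.trans_le (le_max_right _ _)

variable {F : Type*} [NormedField F] [IsUltrametricDist F]

theorem norm_coeff_C_add_X_sub_C_mul_le {r : ℝ} {a z : F} {Q : F[X]} (ha : ‖a‖ ≤ r) (hz : ‖z‖ ≤ 1)
    (hQ : ∀ i, ‖Q.coeff i‖ ≤ r) (i : ℕ) : ‖(C a + (X - C z) * Q).coeff i‖ ≤ r := by
  have hr : 0 ≤ r := (norm_nonneg a).trans ha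
  have hconst : ‖(C a).coeff i‖ ≤ r := by
    rw [coeff_C]
    split_ifs
    exacts [ha, norm_zero.trans_le hr]
  have hshift : ‖(X * Q).coeff i‖ ≤ r := by
    cases i with
    | zero => simpa using hr
    | succ i => simpa using hQ i
  have hscale : ‖(C z * Q).coeff i‖ ≤ r := by
    rw [coeff_C_mul, norm_mul]
    exact (mul_le_of_le_one_left (norm_nonneg _) hz).trans (hQ i)
  rw [sub_mul, coeff_add, coeff_sub]
  exact (IsUltrametricDist.norm_add_le_max _ _).trans
    (max_le hconst ((norm_sub_le_max _ _).trans (max_le hshift hscale)))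

theorem norm_coeff_le_of_norm_eval_le {r : ℝ} (hr : 0 ≤ r) {s : Finset F}
    (hle : ∀ z ∈ s, ‖z‖ ≤ 1) (hsep : (s : Set F).Pairwise fun z w => 1 ≤ ‖z - w‖) {P : F[X]}
    (hdeg : P.degree < s.card) (heval : ∀ z ∈ s, ‖P.eval z‖ ≤ r) (i : ℕ) : ‖P.coeff i‖ ≤ r := by
  classical
  induction s using Finset.induction_on generalizing P i with
  | empty =>
    have hP : P = 0 := by simpa [Nat.WithBot.lt_zero_iff] using hdeg
    simpa [hP] using hr
  | insert z s hz ih =>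
    rw [Finset.card_insert_of_notMem hz] at hdeg
    rw [Finset.forall_mem_insert] at hle heval
    rw [Finset.coe_insert, Set.pairwise_insert] at hsep
    set Q := P /ₘ (X - C z) with hQ
    have hPQ : P = C (P.eval z) + (X - C z) * Q := by
      rw [hQ, ← modByMonic_X_sub_C_eq_C_eval, modByMonic_add_div]
    have hQdeg : Q.degree < s.card := by
      rcases eq_or_ne P 0 with rfl | hP
      · simp [hQ]
      · exact (degree_divByMonic_lt _ _ hP (by simp)).trans_le
          (degree_le_of_natDegree_le
            (Nat.le_of_lt_succ ((natDegree_lt_iff_degree_lt hP).2 hdeg)))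
    have hQeval (w : F) (hw : w ∈ s) : ‖Q.eval w‖ ≤ r := by
      have hdiff : (w - z) * Q.eval w = P.eval w - P.eval z := by
        conv_rhs => rw [hPQ]
        simp
      calc ‖Q.eval w‖ ≤ ‖w - z‖ * ‖Q.eval w‖ :=
            le_mul_of_one_le_left (norm_nonneg _)
              (hsep.2 w hw (ne_of_mem_of_not_mem hw hz).symm).2
        _ = ‖P.eval w - P.eval z‖ := by rw [← norm_mul, hdiff]
        _ ≤ r := (norm_sub_le_max _ _).trans (max_le (heval.2 w hw) heval.1)
    rw [hPQ]
    exact norm_coeff_C_add_X_sub_C_mul_le heval.1 hle.1 (ih hle.2 hsep.1 hQdeg hQeval) i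

end Ultrametric

/-! ### Denominators and least common multiples -/

theorem tendsto_lcm_filter_range {f : ℕ → ℕ} {P : ℕ → Prop} [DecidablePred P] {e : ℕ} (he : e ≠ 0)
    (hdvd : ∀ i, P i → f i ∣ e) (hmin : ∀ l, (∀ i, P i → f i ∣ l) → e ∣ l) :
    Tendsto (fun m => {i ∈ Finset.range m | P i}.lcm f) atTop (𝓝 e) := by
  set l : ℕ → ℕ := fun m => {i ∈ Finset.range m | P i}.lcm f
  have hle (m : ℕ) : l m ∣ e := Finset.lcm_dvd fun i hi => hdvd i (Finset.mem_filter.1 hi).2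
  have hmono {m m' : ℕ} (h : m ≤ m') : l m ∣ l m' :=
    Finset.lcm_mono (Finset.filter_subset_filter _ (Finset.range_mono h))
  obtain ⟨_, ⟨m₀, rfl⟩, hmax⟩ := Set.exists_max_image (Set.range l) id
    ((Set.finite_Iic e).subset (Set.range_subset_iff.2 fun m =>
      Nat.le_of_dvd (Nat.pos_of_ne_zero he) (hle m))) (Set.range_nonempty l)
  have hconst {m : ℕ} (hm : m₀ ≤ m) : l m = l m₀ := (hmax _ ⟨m, rfl⟩).antisymm
    (Nat.le_of_dvd (Nat.pos_of_ne_zero (ne_zero_of_dvd_ne_zero he (hle m))) (hmono hm))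
  have hlim : l m₀ = e := Nat.dvd_antisymm (hle m₀) <| hmin _ fun i hi => by
    rw [← hconst (le_max_left m₀ (i + 1))]
    exact Finset.dvd_lcm (Finset.mem_filter.2 ⟨Finset.mem_range.2 (by lia), hi⟩)
  exact tendsto_const_nhds.congr' (eventually_atTop.2 ⟨m₀, fun m hm => (hlim.symm.trans
    (hconst hm).symm)⟩)

theorem den_dvd_iff_mem_zmultiples {t : ℚ} {e : ℕ} (he : e ≠ 0) :
    t.den ∣ e ↔ t ∈ AddSubgroup.zmultiples (1 / e : ℚ) := by
  have heQ : (e : ℚ) ≠ 0 := Nat.cast_ne_zero.2 he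
  simp only [AddSubgroup.mem_zmultiples_iff, zsmul_eq_mul, mul_one_div]
  constructor
  · rintro ⟨c, rfl⟩
    refine ⟨t.num * c, ?_⟩
    push_cast at heQ ⊢
    rw [mul_div_mul_right _ _ (right_ne_zero_of_mul heQ), Rat.num_div_den]
  · rintro ⟨j, rfl⟩
    exact_mod_cast Rat.den_dvd j e

theorem exists_mem_iff_den_dvd {G : AddSubgroup ℚ} (hone : 1 ∈ G) {n : ℕ} (hn : n ≠ 0)
    (hG : ∀ t ∈ G, t.den ∣ n) : ∃ e ≠ 0, e ∣ n ∧ ∀ t, t ∈ G ↔ t.den ∣ e := by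
  have hnQ : (n : ℚ) ≠ 0 := Nat.cast_ne_zero.2 hn
  obtain ⟨k, hk⟩ := (AddSubgroup.le_zmultiples_iff (1 / n : ℚ) G).1 fun t ht =>
    (den_dvd_iff_mem_zmultiples hn).1 (hG t ht)
  obtain ⟨m, hm⟩ : ∃ m : ℤ, m * k = n := by
    obtain ⟨m, hm⟩ := AddSubgroup.mem_zmultiples_iff.1 (hk ▸ hone)
    refine ⟨m, ?_⟩
    rw [zsmul_eq_mul, nsmul_eq_mul, mul_one_div, mul_div_assoc', div_eq_one_iff_eq hnQ] at hm
    exact_mod_cast hm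
  obtain ⟨e, rfl⟩ : k ∣ n := Int.natCast_dvd_natCast.1 ⟨m, by rw [← hm, mul_comm]⟩
  have he : e ≠ 0 := right_ne_zero_of_mul hn
  refine ⟨e, he, dvd_mul_left e k, fun t => ?_⟩
  rw [den_dvd_iff_mem_zmultiples he, hk, nsmul_eq_mul, Nat.cast_mul, mul_one_div,
    div_mul_cancel_left₀ (Nat.cast_ne_zero.2 (left_ne_zero_of_mul hn)), one_div]

theorem one_div_le_of_den_dvd {t : ℚ} (ht : 0 < t) {e : ℕ} (h : t.den ∣ e) : 1 / (e : ℚ) ≤ t := by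
  rcases Nat.eq_zero_or_pos e with rfl | he
  · simpa using ht.le
  calc 1 / (e : ℚ) ≤ 1 / t.den :=
        one_div_le_one_div_of_le (Nat.cast_pos.2 t.pos) (Nat.cast_le.2 (Nat.le_of_dvd he h))
    _ ≤ t.num / t.den := by
        have : (1 : ℚ) ≤ t.num := by exact_mod_cast Rat.num_pos.2 ht
        gcongr
    _ = t := t.num_div_den

variable {p : ℕ} [Fact p.Prime]

/-! ### Teichmüller representatives -/

theorem pow_pow_eq_self_of_dvd {M : Type*} [Monoid M] {z : M} {q k l : ℕ} (h : z ^ q ^ k = z)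
    (hkl : k ∣ l) : z ^ q ^ l = z := by
  obtain ⟨n, rfl⟩ := hkl
  induction n with
  | zero => simp
  | succ n ih => rw [Nat.mul_succ, pow_add, pow_mul, ih, h]

/-- `z` is the Teichmüller representative of some digit; equivalently, `z` is `0` or a root of unity
of order prime to `p`. -/
def IsTeichmullerRep (z : PadicAlgCl p) : Prop := ∃ k : ℕ, 1 ≤ k ∧ z ^ p ^ k = z

open Classical in
/-- The reduction of an element of the valuation ring modulo the maximal ideal, extended by the junk
value `0` to all of `PadicAlgCl p`. -/
noncomputable def reduction (z : PadicAlgCl p) : Digit p :=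
  if h : z ∈ IntRing p then IsLocalRing.residue (IntRing p) ⟨z, h⟩ else 0

theorem reduction_coe (z : IntRing p) :
    reduction (z : PadicAlgCl p) = IsLocalRing.residue (IntRing p) z := dif_pos z.2

theorem reduction_eq_reduction_iff {z w : PadicAlgCl p} (hz : ‖z‖ ≤ 1) (hw : ‖w‖ ≤ 1) :
    reduction z = reduction w ↔ ‖z - w‖ < 1 := by
  lift z to IntRing p using mem_intRing.2 hz
  lift w to IntRing p using mem_intRing.2 hw
  rw [reduction_coe, reduction_coe, ← sub_eq_zero, ← map_sub, residue_eq_zero]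
  rfl

theorem isTeichmuller_teichmuller (a : Digit p) :
    ∃ z : IntRing p, (z : PadicAlgCl p) = teichmuller a ∧ IsTeichmuller p a z :=
  ⟨_, rfl, (existsUnique_teichmuller a).choose_spec.1⟩

theorem isTeichmullerRep_teichmuller (a : Digit p) : IsTeichmullerRep (teichmuller a) := by
  obtain ⟨z, hz, -, k, hk, hzk⟩ := isTeichmuller_teichmuller a
  exact ⟨k, hk, by rw [← hz]; exact congrArg Subtype.val hzk⟩

theorem reduction_teichmuller (a : Digit p) : reduction (teichmuller a) = a := by
  obtain ⟨z, hz, hza, -⟩ := isTeichmuller_teichmuller a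
  rw [← hz, reduction_coe, hza]

theorem teichmuller_injective : Function.Injective (teichmuller (p := p)) :=
  Function.LeftInverse.injective reduction_teichmuller

namespace IsTeichmullerRep

variable {z w : PadicAlgCl p}

theorem zero : IsTeichmullerRep (0 : PadicAlgCl p) :=
  ⟨1, le_rfl, zero_pow (pow_ne_zero _ (Fact.out : p.Prime).ne_zero)⟩

theorem mul (hz : IsTeichmullerRep z) (hw : IsTeichmullerRep w) : IsTeichmullerRep (z * w) := by
  obtain ⟨k, hk, hz⟩ := hz
  obtain ⟨l, hl, hw⟩ := hw
  refine ⟨k * l, Nat.mul_pos hk hl, ?_⟩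
  rw [mul_pow, pow_pow_eq_self_of_dvd hz (dvd_mul_right k l),
    pow_pow_eq_self_of_dvd hw (dvd_mul_left l k)]

theorem pow (hz : IsTeichmullerRep z) (n : ℕ) : IsTeichmullerRep (z ^ n) := by
  obtain ⟨k, hk, hz⟩ := hz
  exact ⟨k, hk, by rw [pow_right_comm, hz]⟩

theorem map (hz : IsTeichmullerRep z) (σ : Gal(PadicAlgCl p/ℚ_[p])) : IsTeichmullerRep (σ z) := by
  obtain ⟨k, hk, hz⟩ := hz
  exact ⟨k, hk, by rw [← map_pow, hz]⟩

theorem of_pow_eq_one {m : ℕ} (hm : ¬ p ∣ m) (h : z ^ m = 1) : IsTeichmullerRep z := by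
  have hp : p.Prime := Fact.out
  have hm0 : 0 < m := Nat.pos_of_ne_zero fun h0 => hm (h0 ▸ dvd_zero p)
  refine ⟨m.totient, Nat.totient_pos.2 hm0, ?_⟩
  obtain ⟨c, hc⟩ := (Nat.modEq_iff_dvd' (Nat.one_le_pow _ _ hp.pos)).1
    (Nat.ModEq.pow_totient (hp.coprime_iff_not_dvd.2 hm)).symm
  rw [← Nat.sub_add_cancel (Nat.one_le_pow m.totient p hp.pos), hc, pow_succ, pow_mul, h, one_pow,
    one_mul]

theorem norm_eq_one (hz : IsTeichmullerRep z) (h0 : z ≠ 0) : ‖z‖ = 1 := by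
  obtain ⟨k, hk, hz⟩ := hz
  have hq : 1 < p ^ k := Nat.one_lt_pow (Nat.one_le_iff_ne_zero.1 hk) (Fact.out : p.Prime).one_lt
  have hroot : z ^ (p ^ k - 1) = 1 := by
    apply mul_right_cancel₀ h0
    rw [← pow_succ, Nat.sub_add_cancel hq.le, hz, one_mul]
  exact (isOfFinOrder_iff_pow_eq_one.2 ⟨_, Nat.sub_pos_of_lt hq, hroot⟩).norm_eq_one

theorem norm_le_one (hz : IsTeichmullerRep z) : ‖z‖ ≤ 1 := by
  rcases eq_or_ne z 0 with rfl | h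
  · simp
  · exact (hz.norm_eq_one h).le

theorem teichmuller_reduction (hz : IsTeichmullerRep z) : teichmuller (reduction z) = z := by
  obtain ⟨k, hk, hzk⟩ := id hz
  lift z to IntRing p using mem_intRing.2 hz.norm_le_one
  rw [reduction_coe]
  exact congrArg Subtype.val
    ((existsUnique_teichmuller _).choose_spec.2 z ⟨rfl, k, hk, Subtype.ext hzk⟩).symm

theorem eq_of_norm_sub_lt_one (hz : IsTeichmullerRep z) (hw : IsTeichmullerRep w)
    (h : ‖z - w‖ < 1) : z = w := by
  rw [← hz.teichmuller_reduction, ← hw.teichmuller_reduction,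
    (reduction_eq_reduction_iff hz.norm_le_one hw.norm_le_one).2 h]

end IsTeichmullerRep

theorem teichmuller_zero : teichmuller (0 : Digit p) = 0 := by
  have h := IsTeichmullerRep.zero.teichmuller_reduction (p := p)
  rwa [← ZeroMemClass.coe_zero (IntRing p), reduction_coe, map_zero] at h

theorem teichmuller_ne_zero {a : Digit p} (ha : a ≠ 0) : teichmuller a ≠ 0 :=
  teichmuller_zero (p := p) ▸ teichmuller_injective.ne ha

theorem norm_teichmuller {a : Digit p} (ha : a ≠ 0) : ‖teichmuller a‖ = 1 :=
  (isTeichmullerRep_teichmuller a).norm_eq_one (teichmuller_ne_zero ha)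

theorem norm_sub_teichmuller_lt_one_iff {z : PadicAlgCl p} (hz : ‖z‖ ≤ 1) {a : Digit p} :
    ‖z - teichmuller a‖ < 1 ↔ reduction z = a := by
  rw [← reduction_eq_reduction_iff hz (isTeichmullerRep_teichmuller a).norm_le_one,
    reduction_teichmuller]

theorem exists_isTeichmullerRep_forall_mem_pow_eq {S : Set (PadicAlgCl p)} (hS : S.Finite)
    (hrep : ∀ z ∈ S, IsTeichmullerRep z) :
    ∃ ζ : PadicAlgCl p, IsTeichmullerRep ζ ∧ ∀ z ∈ S, z = 0 ∨ ∃ n : ℕ, ζ ^ n = z := by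
  obtain ⟨k, hk, hperiod⟩ : ∃ k : ℕ, 1 ≤ k ∧ ∀ z ∈ S, z ^ p ^ k = z := by
    choose! k hk hzk using hrep
    refine ⟨∏ z ∈ hS.toFinset, k z, Finset.one_le_prod' fun z hz => hk z (by simpa using hz),
      fun z hz => pow_pow_eq_self_of_dvd (hzk z hz) (Finset.dvd_prod_of_mem k (by simpa using hz))⟩
  have hq : 1 < p ^ k := Nat.one_lt_pow (Nat.one_le_iff_ne_zero.1 hk) (Fact.out : p.Prime).one_lt
  have : NeZero (p ^ k - 1) := ⟨(Nat.sub_pos_of_lt hq).ne'⟩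
  obtain ⟨ζ, hζ⟩ := HasEnoughRootsOfUnity.exists_primitiveRoot (PadicAlgCl p) (p ^ k - 1)
  have hpow (z : PadicAlgCl p) : z ^ p ^ k = z ^ (p ^ k - 1) * z := by
    rw [← pow_succ, Nat.sub_add_cancel hq.le]
  refine ⟨ζ, ⟨k, hk, by rw [hpow, hζ.pow_eq_one, one_mul]⟩, fun z hz => or_iff_not_imp_left.2
    fun hz0 => ?_⟩
  have hroot : z ^ (p ^ k - 1) = 1 :=
    mul_right_cancel₀ hz0 (by rw [← hpow, hperiod z hz, one_mul])
  obtain ⟨n, -, hn⟩ := hζ.eq_pow_of_pow_eq_one hroot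
  exact ⟨n, hn⟩

theorem exists_finite_subfield_of_isIntegral (k₀ : Type*) {F : Type*} [Field k₀] [Finite k₀]
    [Field F] [Algebra k₀ F] {D : Set F} (hD : D.Finite) (hint : ∀ a ∈ D, IsIntegral k₀ a) :
    ∃ k : Subfield F, Finite k ∧ D ⊆ k := by
  have := hD.to_subtype
  have := IntermediateField.finiteDimensional_adjoin hint
  exact ⟨(IntermediateField.adjoin k₀ D).toSubfield,
    Module.finite_of_finite k₀ (M := IntermediateField.adjoin k₀ D),
    IntermediateField.subset_adjoin k₀ D⟩

theorem isIntegral_digit [Algebra (ZMod p) (Digit p)] (a : Digit p) : IsIntegral (ZMod p) a := by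
  obtain ⟨k, hk, ha⟩ := digit_pow_eq a
  have hq : 1 < p ^ k := Nat.one_lt_pow (Nat.one_le_iff_ne_zero.1 hk) (Fact.out : p.Prime).one_lt
  exact ⟨X ^ p ^ k - X, monic_X_pow_sub (by rw [degree_X]; exact_mod_cast hq), by simp [ha]⟩

theorem exists_finite_subfield_digit {D : Set (Digit p)} (hD : D.Finite) :
    ∃ k : Subfield (Digit p), Finite k ∧ D ⊆ k := by
  have : CharP (Digit p) p :=
    (CharP.charP_iff_prime_eq_zero (Fact.out : p.Prime)).2 digit_natCast_p
  let := ZMod.algebra (Digit p) p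
  exact exists_finite_subfield_of_isIntegral (ZMod p) hD fun a _ => isIntegral_digit a

theorem norm_algEquiv (σ : Gal(PadicAlgCl p/ℚ_[p])) (y : PadicAlgCl p) : ‖σ y‖ = ‖y‖ :=
  (spectralNorm_eq_of_equiv σ y).symm

theorem continuous_algEquiv (σ : Gal(PadicAlgCl p/ℚ_[p])) : Continuous σ :=
  (AddMonoidHomClass.isometry_of_norm σ (norm_algEquiv σ)).continuous

theorem mem_iff_forall_algEquiv_eq {K : IntermediateField ℚ_[p] (PadicAlgCl p)}
    {y : PadicAlgCl p} :
    y ∈ K ↔ ∀ σ : Gal(PadicAlgCl p/ℚ_[p]), (∀ z ∈ K, σ z = z) → σ y = y := by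
  conv_lhs => rw [← InfiniteGalois.fixedField_fixingSubgroup K]
  simp only [IntermediateField.mem_fixedField_iff, IntermediateField.mem_fixingSubgroup_iff]

theorem isClosed_intermediateField (K : IntermediateField ℚ_[p] (PadicAlgCl p)) :
    IsClosed (K : Set (PadicAlgCl p)) := by
  have hK : (K : Set (PadicAlgCl p)) =
      ⋂ (σ : Gal(PadicAlgCl p/ℚ_[p])) (_ : ∀ z ∈ K, σ z = z), {y | σ y = y} := by
    ext y
    simpa using mem_iff_forall_algEquiv_eq
  rw [hK]
  exact isClosed_iInter fun σ => isClosed_iInter fun _ =>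
    isClosed_eq (continuous_algEquiv σ) continuous_id

theorem finite_isTeichmullerRep (K : IntermediateField ℚ_[p] (PadicAlgCl p))
    [FiniteDimensional ℚ_[p] K] : {z : PadicAlgCl p | z ∈ K ∧ IsTeichmullerRep z}.Finite := by
  have : ProperSpace K := FiniteDimensional.proper ℚ_[p] K
  set S : Set K := {z | IsTeichmullerRep (z : PadicAlgCl p)}
  have hsep : S.Pairwise fun z w => 1 ≤ dist z w := fun z hz w hw hzw => by
    change 1 ≤ dist (z : PadicAlgCl p) w
    rw [dist_eq_norm]
    exact le_of_not_gt fun hlt => hzw (Subtype.ext (hz.eq_of_norm_sub_lt_one hw hlt))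
  have hdiscrete : IsDiscrete S :=
    ⟨.of_forall_le_dist one_pos fun z w hzw => hsep z.2 w.2 (Subtype.coe_ne_coe.2 hzw)⟩
  have hfin := Metric.finite_isBounded_inter_isClosed hdiscrete
    (Metric.isBounded_closedBall (x := (0 : K)) (r := 1))
    (Metric.isClosed_of_pairwise_le_dist one_pos hsep)
  refine (hfin.image ((↑) : K → PadicAlgCl p)).subset ?_
  rintro z ⟨hzK, hz⟩
  exact ⟨⟨z, hzK⟩, ⟨mem_closedBall_zero_iff.2 hz.norm_le_one, hz⟩, rfl⟩

theorem finite_setOf_teichmuller_pow_mem (K : IntermediateField ℚ_[p] (PadicAlgCl p))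
    [FiniteDimensional ℚ_[p] K] {e : ℕ} (he : e ≠ 0) :
    {a : Digit p | teichmuller a ^ e ∈ K}.Finite := by
  classical
  have hroots : ((fun z : PadicAlgCl p => z ^ e) ⁻¹' {z | z ∈ K ∧ IsTeichmullerRep z}).Finite :=
    (finite_isTeichmullerRep K).preimage' fun c _ =>
      (nthRoots e c).toFinset.finite_toSet.subset fun z hz => by
        rwa [Finset.mem_coe, Multiset.mem_toFinset, mem_nthRoots (Nat.pos_of_ne_zero he)]
  exact (hroots.preimage teichmuller_injective.injOn).subset fun a ha =>
    ⟨ha, (isTeichmullerRep_teichmuller a).pow e⟩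

/-! ### Value groups and the ramification index -/

theorem norm_natCast_p : ‖(p : PadicAlgCl p)‖ = (p : ℝ)⁻¹ := by
  rw [← map_natCast (algebraMap ℚ_[p] (PadicAlgCl p)), PadicAlgCl.norm_extends, Padic.norm_p]

theorem rpow_neg_lt_rpow_neg_iff {s t : ℚ} : (p : ℝ) ^ (-s : ℝ) < (p : ℝ) ^ (-t : ℝ) ↔ t < s := by
  rw [Real.rpow_lt_rpow_left_iff (Nat.one_lt_cast.2 (Fact.out : p.Prime).one_lt),
    neg_lt_neg_iff, Rat.cast_lt]

theorem rpow_neg_injective : Function.Injective fun t : ℚ => (p : ℝ) ^ (-t : ℝ) :=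
  StrictAnti.injective fun _ _ h => rpow_neg_lt_rpow_neg_iff.2 h

/-- The extension of the `p`-adic valuation to `PadicAlgCl p`, normalized by `ord p = 1`. As
conjugates have equal valuation, it is the valuation of the constant coefficient of the minimal
polynomial divided by the degree. At `0` it takes the junk value `0`. -/
noncomputable def ord (y : PadicAlgCl p) : ℚ :=
  ((minpoly ℚ_[p] y).coeff 0).valuation / (minpoly ℚ_[p] y).natDegree

theorem norm_eq_rpow_neg_ord {y : PadicAlgCl p} (hy : y ≠ 0) : ‖y‖ = (p : ℝ) ^ (-ord y : ℝ) := by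
  have hcoeff : (minpoly ℚ_[p] y).coeff 0 ≠ 0 :=
    minpoly.coeff_zero_ne_zero (Algebra.IsIntegral.isIntegral y) hy
  have h := spectralNorm.spectralNorm_eq_norm_coeff_zero_rpow ℚ_[p] (PadicAlgCl p) y
  rw [PadicAlgCl.spectralNorm_eq, Padic.norm_eq_zpow_neg_valuation hcoeff, ← Real.rpow_intCast,
    ← Real.rpow_mul p.cast_nonneg] at h
  rw [h, ord]
  push_cast
  ring_nf

theorem ord_eq_iff {y : PadicAlgCl p} (hy : y ≠ 0) {t : ℚ} :
    ord y = t ↔ ‖y‖ = (p : ℝ) ^ (-t : ℝ) := by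
  rw [norm_eq_rpow_neg_ord hy]
  exact rpow_neg_injective.eq_iff.symm

theorem ord_lt_ord_iff {y z : PadicAlgCl p} (hy : y ≠ 0) (hz : z ≠ 0) :
    ord y < ord z ↔ ‖z‖ < ‖y‖ := by
  rw [norm_eq_rpow_neg_ord hy, norm_eq_rpow_neg_ord hz, rpow_neg_lt_rpow_neg_iff]

theorem ord_one : ord (1 : PadicAlgCl p) = 0 := (ord_eq_iff one_ne_zero).2 (by simp)

theorem ord_natCast_p : ord (p : PadicAlgCl p) = 1 :=
  (ord_eq_iff (Nat.cast_ne_zero.2 (Fact.out : p.Prime).ne_zero)).2 (by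
    rw [norm_natCast_p, Rat.cast_one, Real.rpow_neg_one])

theorem ord_mul {y z : PadicAlgCl p} (hy : y ≠ 0) (hz : z ≠ 0) : ord (y * z) = ord y + ord z := by
  rw [ord_eq_iff (mul_ne_zero hy hz), norm_mul, norm_eq_rpow_neg_ord hy, norm_eq_rpow_neg_ord hz,
    ← Real.rpow_add (Nat.cast_pos.2 (Fact.out : p.Prime).pos)]
  push_cast
  ring_nf

theorem ord_inv {y : PadicAlgCl p} (hy : y ≠ 0) : ord y⁻¹ = -ord y := by
  rw [eq_neg_iff_add_eq_zero, ← ord_mul (inv_ne_zero hy) hy, inv_mul_cancel₀ hy, ord_one]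

theorem ord_algebraMap {c : ℚ_[p]} (hc : c ≠ 0) :
    ord (algebraMap ℚ_[p] (PadicAlgCl p) c) = c.valuation := by
  rw [ord_eq_iff ((_root_.map_ne_zero _).2 hc), PadicAlgCl.norm_extends,
    Padic.norm_eq_zpow_neg_valuation hc, ← Real.rpow_intCast]
  push_cast
  rfl

theorem den_ord_dvd_natDegree_minpoly (y : PadicAlgCl p) :
    (ord y).den ∣ (minpoly ℚ_[p] y).natDegree := by
  have h := Rat.den_dvd ((minpoly ℚ_[p] y).coeff 0).valuation (minpoly ℚ_[p] y).natDegree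
  rw [ord]
  exact_mod_cast h

variable (p) in
/-- The value group of a field `A` embedded in `PadicAlgCl p`, written additively. -/
noncomputable def valueGroup (A : Type*) [Field A] [Algebra A (PadicAlgCl p)] : AddSubgroup ℚ where
  carrier := {t | ∃ y : A, y ≠ 0 ∧ ord (algebraMap A (PadicAlgCl p) y) = t}
  zero_mem' := ⟨1, one_ne_zero, by rw [map_one, ord_one]⟩
  add_mem' := by
    rintro _ _ ⟨y, hy, rfl⟩ ⟨z, hz, rfl⟩
    exact ⟨y * z, mul_ne_zero hy hz, by
      rw [map_mul, ord_mul ((_root_.map_ne_zero _).2 hy) ((_root_.map_ne_zero _).2 hz)]⟩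
  neg_mem' := by
    rintro _ ⟨y, hy, rfl⟩
    exact ⟨y⁻¹, inv_ne_zero hy, by rw [map_inv₀, ord_inv ((_root_.map_ne_zero _).2 hy)]⟩

theorem ord_mem_valueGroup {K : IntermediateField ℚ_[p] (PadicAlgCl p)} {y : PadicAlgCl p}
    (hy : y ∈ K) : ord y ∈ valueGroup p K := by
  rcases eq_or_ne y 0 with rfl | hy0
  · simp [ord]
  · exact ⟨⟨y, hy⟩, Subtype.coe_ne_coe.1 hy0, rfl⟩

theorem exists_ord_eq_of_mem_valueGroup {K : IntermediateField ℚ_[p] (PadicAlgCl p)} {t : ℚ}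
    (ht : t ∈ valueGroup p K) : ∃ y ∈ K, y ≠ 0 ∧ ord y = t := by
  obtain ⟨y, hy, rfl⟩ := ht
  exact ⟨y, y.2, (_root_.map_ne_zero (algebraMap K (PadicAlgCl p))).2 hy, rfl⟩

theorem valueGroup_mono {K L : IntermediateField ℚ_[p] (PadicAlgCl p)} (h : K ≤ L) :
    valueGroup p K ≤ valueGroup p L := by
  intro t ht
  obtain ⟨y, hy, -, rfl⟩ := exists_ord_eq_of_mem_valueGroup ht
  exact ord_mem_valueGroup (h hy)

theorem valueGroup_padic : valueGroup p ℚ_[p] = AddSubgroup.zmultiples 1 := by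
  ext t
  rw [AddSubgroup.mem_zmultiples_iff]
  constructor
  · rintro ⟨y, hy, rfl⟩
    exact ⟨y.valuation, by rw [ord_algebraMap hy, zsmul_one]⟩
  · rintro ⟨k, rfl⟩
    have hone : (1 : ℚ) ∈ valueGroup p ℚ_[p] :=
      ⟨p, Nat.cast_ne_zero.2 (Fact.out : p.Prime).ne_zero, by rw [map_natCast, ord_natCast_p]⟩
    exact zsmul_mem hone k

variable (p) in
/-- The absolute value `p ^ (-t)` of the elements of valuation `t`; it identifies the additive value
groups with the multiplicative ones of `ramificationIndex`. -/
noncomputable def absOfOrd : Multiplicative ℚ →* ℝ≥0ˣ :=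
  MonoidHom.toHomUnits
    { toFun := fun t => (p : ℝ≥0) ^ (-t.toAdd : ℝ)
      map_one' := by simp
      map_mul' := fun _ _ => by
        rw [← NNReal.rpow_add (Nat.cast_ne_zero.2 (Fact.out : p.Prime).ne_zero)]
        simp [add_comm] }

theorem absOfOrd_injective : Function.Injective (absOfOrd p) := fun _ _ h =>
  rpow_neg_injective (p := p) (congrArg (fun c : ℝ≥0ˣ => ((c : ℝ≥0) : ℝ)) h)

theorem range_units_map_valued (A : Type*) [Field A] [Algebra A (PadicAlgCl p)] :
    ((Units.map (Valued.v : Valuation (PadicAlgCl p) ℝ≥0).toMonoidHom).comp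
      (Units.map (algebraMap A (PadicAlgCl p)).toMonoidHom)).range =
    (valueGroup p A).toSubgroup.map (absOfOrd p) := by
  have hval (y : Aˣ) : (Units.map (Valued.v : Valuation (PadicAlgCl p) ℝ≥0).toMonoidHom).comp
      (Units.map (algebraMap A (PadicAlgCl p)).toMonoidHom) y =
      absOfOrd p (Multiplicative.ofAdd (ord (algebraMap A (PadicAlgCl p) y))) :=
    Units.ext (NNReal.coe_injective
      (norm_eq_rpow_neg_ord ((_root_.map_ne_zero (algebraMap A (PadicAlgCl p))).2 y.ne_zero)))
  ext c
  constructor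
  · rintro ⟨y, rfl⟩
    exact ⟨_, ⟨y, y.ne_zero, rfl⟩, (hval y).symm⟩
  · rintro ⟨_, ⟨y, hy, ht⟩, rfl⟩
    exact ⟨Units.mk0 y hy, (hval _).trans (congrArg (absOfOrd p) ht)⟩

theorem ramificationIndex_eq_relIndex (K : IntermediateField ℚ_[p] (PadicAlgCl p)) :
    ramificationIndex p K = (valueGroup p ℚ_[p]).relIndex (valueGroup p K) := by
  rw [ramificationIndex, range_units_map_valued ℚ_[p], range_units_map_valued K,
    Subgroup.relIndex_map_map_of_injective _ _ absOfOrd_injective, AddSubgroup.relIndex_toSubgroup]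

theorem ramificationIndex_eq {K : IntermediateField ℚ_[p] (PadicAlgCl p)} {e : ℕ} (he : e ≠ 0)
    (hK : ∀ t, t ∈ valueGroup p K ↔ t.den ∣ e) : ramificationIndex p K = e := by
  have heQ : (e : ℚ) ≠ 0 := Nat.cast_ne_zero.2 he
  let f : ℤ →+ ℚ := zmultiplesHom ℚ (1 / e : ℚ)
  have hrange : valueGroup p K = f.range := by
    ext t
    rw [hK, den_dvd_iff_mem_zmultiples he]
    rfl
  have hcomap : (AddSubgroup.zmultiples (1 : ℚ)).comap f = AddSubgroup.zmultiples (e : ℤ) := by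
    ext m
    rw [AddSubgroup.mem_comap, AddSubgroup.mem_zmultiples_iff, Int.mem_zmultiples_iff, dvd_def]
    refine exists_congr fun k => ?_
    rw [zmultiplesHom_apply, zsmul_one, zsmul_eq_mul, mul_one_div, eq_div_iff heQ, mul_comm,
      eq_comm]
    norm_cast
  rw [ramificationIndex_eq_relIndex, valueGroup_padic, hrange, ← AddSubgroup.index_comap, hcomap,
    Int.index_zmultiples, Int.natAbs_natCast]

section FiniteDimensional

variable (K : IntermediateField ℚ_[p] (PadicAlgCl p)) [FiniteDimensional ℚ_[p] K]

theorem exists_mem_valueGroup_iff :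
    ∃ e ≠ 0, e ∣ Module.finrank ℚ_[p] K ∧ ∀ t, t ∈ valueGroup p K ↔ t.den ∣ e := by
  refine exists_mem_iff_den_dvd (ord_natCast_p (p := p) ▸ ord_mem_valueGroup (natCast_mem K p))
    Module.finrank_pos.ne' fun t ht => ?_
  obtain ⟨y, -, rfl⟩ := ht
  refine (den_ord_dvd_natDegree_minpoly _).trans ?_
  rw [minpoly.algebraMap_eq (algebraMap K (PadicAlgCl p)).injective]
  exact minpoly.degree_dvd (Algebra.IsIntegral.isIntegral y)

theorem ramificationIndex_ne_zero : ramificationIndex p K ≠ 0 := by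
  obtain ⟨e, he, -, hK⟩ := exists_mem_valueGroup_iff K
  rwa [ramificationIndex_eq he hK]

theorem ramificationIndex_dvd_finrank : ramificationIndex p K ∣ Module.finrank ℚ_[p] K := by
  obtain ⟨e, he, hdvd, hK⟩ := exists_mem_valueGroup_iff K
  rwa [ramificationIndex_eq he hK]

variable {K}

theorem mem_valueGroup_iff_den_dvd {t : ℚ} :
    t ∈ valueGroup p K ↔ t.den ∣ ramificationIndex p K := by
  obtain ⟨e, he, -, hK⟩ := exists_mem_valueGroup_iff K
  rw [ramificationIndex_eq he hK, hK]

theorem ramificationIndex_dvd_iff {l : ℕ} :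
    ramificationIndex p K ∣ l ↔ ∀ t ∈ valueGroup p K, t.den ∣ l := by
  refine ⟨fun h t ht => (mem_valueGroup_iff_den_dvd.1 ht).trans h, fun h => ?_⟩
  have hmem : (1 / ramificationIndex p K : ℚ) ∈ valueGroup p K := by
    rw [mem_valueGroup_iff_den_dvd, den_dvd_iff_mem_zmultiples (ramificationIndex_ne_zero K)]
    exact AddSubgroup.mem_zmultiples _
  simpa [ramificationIndex_ne_zero] using h _ hmem

end FiniteDimensional

/-! ### Rational powers of `p` and leading terms -/

namespace IsPowerSystem

variable {ω : ℚ → PadicAlgCl p} (hω : IsPowerSystem p ω)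

include hω

theorem map_zero : ω 0 = 1 := by
  have hp : (p : PadicAlgCl p) ≠ 0 := Nat.cast_ne_zero.2 (Fact.out : p.Prime).ne_zero
  refine mul_left_cancel₀ hp ?_
  rw [← hω.map_one, ← hω.map_add, add_zero, mul_one]

theorem map_mul_map_neg (t : ℚ) : ω t * ω (-t) = 1 := by
  rw [← hω.map_add, add_neg_cancel, hω.map_zero]

theorem ne_zero (t : ℚ) : ω t ≠ 0 := left_ne_zero_of_mul_eq_one (hω.map_mul_map_neg t)

theorem map_neg (t : ℚ) : ω (-t) = (ω t)⁻¹ := eq_inv_of_mul_eq_one_right (hω.map_mul_map_neg t)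

theorem map_nsmul (n : ℕ) (t : ℚ) : ω (n • t) = ω t ^ n := by
  induction n with
  | zero => rw [zero_smul, hω.map_zero, pow_zero]
  | succ n ih => rw [succ_nsmul, hω.map_add, ih, pow_succ]

theorem map_zsmul (n : ℤ) (t : ℚ) : ω (n • t) = ω t ^ n := by
  obtain ⟨m, rfl | rfl⟩ := n.eq_nat_or_neg
  · rw [natCast_zsmul, hω.map_nsmul, zpow_natCast]
  · rw [neg_smul, natCast_zsmul, hω.map_neg, hω.map_nsmul, zpow_neg, zpow_natCast]

theorem pow_den (t : ℚ) : ω t ^ t.den = (p : PadicAlgCl p) ^ t.num := by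
  rw [← hω.map_nsmul, nsmul_eq_mul, Rat.den_mul_eq_num, ← zsmul_one, hω.map_zsmul, hω.map_one]

theorem pow_den_mem (t : ℚ) (K : IntermediateField ℚ_[p] (PadicAlgCl p)) : ω t ^ t.den ∈ K := by
  rw [hω.pow_den]
  exact zpow_mem (natCast_mem K p) _

theorem mem_adjoin_of_den_dvd {t : ℚ} {l : ℕ} (hl : l ≠ 0) (h : t.den ∣ l) :
    ω t ∈ ℚ_[p]⟮ω (1 / l)⟯ := by
  obtain ⟨k, rfl⟩ := (den_dvd_iff_mem_zmultiples hl).1 h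
  rw [hω.map_zsmul]
  exact zpow_mem (IntermediateField.mem_adjoin_simple_self ℚ_[p] _) k

theorem ord_eq (t : ℚ) : ord (ω t) = t := by
  let f : ℚ →+ ℚ := AddMonoidHom.mk' (fun s => ord (ω s)) fun s s' => by
    rw [hω.map_add, ord_mul (hω.ne_zero s) (hω.ne_zero s')]
  have hone : f 1 = 1 := by rw [AddMonoidHom.mk'_apply, hω.map_one, ord_natCast_p]
  have h : f t = t * f 1 := by simpa using map_rat_smul f t 1
  rwa [hone, mul_one] at h

theorem norm_ord {y : PadicAlgCl p} (hy : y ≠ 0) : ‖ω (ord y)‖ = ‖y‖ := by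
  rw [norm_eq_rpow_neg_ord hy, ← ord_eq_iff (hω.ne_zero _), hω.ord_eq]

theorem norm_lt_norm_iff {s t : ℚ} : ‖ω s‖ < ‖ω t‖ ↔ t < s := by
  rw [← ord_lt_ord_iff (hω.ne_zero t) (hω.ne_zero s), hω.ord_eq, hω.ord_eq]

end IsPowerSystem

section LeadingTerm

variable {ω : ℚ → PadicAlgCl p} {y : PadicAlgCl p}

/-- The first digit of the expansion of `y`; it is `0` for `y = 0`. -/
noncomputable def leadingDigit (ω : ℚ → PadicAlgCl p) (y : PadicAlgCl p) : Digit p :=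
  reduction (y / ω (ord y))

/-- The first term of the expansion of `y`; it is `0` for `y = 0`. -/
noncomputable def leadingTerm (ω : ℚ → PadicAlgCl p) (y : PadicAlgCl p) : PadicAlgCl p :=
  teichmuller (leadingDigit ω y) * ω (ord y)

theorem IsPowerSystem.norm_sub_leadingTerm_lt (hω : IsPowerSystem p ω) (hy : y ≠ 0) :
    ‖y - leadingTerm ω y‖ < ‖y‖ := by
  have hunit : ‖y / ω (ord y)‖ = 1 := by
    rw [norm_div, hω.norm_ord hy, div_self (norm_ne_zero_iff.2 hy)]
  have hlt : ‖y / ω (ord y) - teichmuller (leadingDigit ω y)‖ < 1 :=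
    (norm_sub_teichmuller_lt_one_iff hunit.le).2 rfl
  calc ‖y - leadingTerm ω y‖
      = ‖y / ω (ord y) - teichmuller (leadingDigit ω y)‖ * ‖y‖ := by
        rw [← hω.norm_ord hy, ← norm_mul, sub_mul, div_mul_cancel₀ _ (hω.ne_zero _), leadingTerm]
    _ < ‖y‖ := mul_lt_of_lt_one_left (norm_pos_iff.2 hy) hlt

theorem IsPowerSystem.leadingDigit_ne_zero (hω : IsPowerSystem p ω) (hy : y ≠ 0) :
    leadingDigit ω y ≠ 0 := fun h => by
  have hlt := hω.norm_sub_leadingTerm_lt hy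
  rw [leadingTerm, h, teichmuller_zero, zero_mul, sub_zero] at hlt
  exact lt_irrefl _ hlt

theorem IsPowerSystem.ord_eq_and_leadingDigit_eq (hω : IsPowerSystem p ω) {t : ℚ} {a : Digit p}
    (ha : a ≠ 0) (h : ‖y - teichmuller a * ω t‖ < ‖ω t‖) : ord y = t ∧ leadingDigit ω y = a := by
  have hterm : ‖teichmuller a * ω t‖ = ‖ω t‖ := by rw [norm_mul, norm_teichmuller ha, one_mul]
  have hnorm : ‖y‖ = ‖ω t‖ := (norm_eq_of_norm_sub_lt (h.trans_eq hterm.symm)).trans hterm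
  have hpos : 0 < ‖ω t‖ := norm_pos_iff.2 (hω.ne_zero t)
  have hord : ord y = t := by
    rw [ord_eq_iff (norm_pos_iff.1 (hnorm ▸ hpos)), hnorm, ← ord_eq_iff (hω.ne_zero t), hω.ord_eq]
  refine ⟨hord, ?_⟩
  have hunit : ‖y / ω t‖ = 1 := by rw [norm_div, hnorm, div_self hpos.ne']
  rw [leadingDigit, hord, ← norm_sub_teichmuller_lt_one_iff hunit.le,
    ← mul_lt_iff_lt_one_left hpos, ← norm_mul, sub_mul, div_mul_cancel₀ _ (hω.ne_zero t)]
  exact h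

end LeadingTerm

/-! ### Adjoining the Teichmüller representatives -/

section AdjoinTeichmuller

variable {K : IntermediateField ℚ_[p] (PadicAlgCl p)} {ζ : PadicAlgCl p}

theorem norm_coeff_le_norm_aeval (hζ : IsTeichmullerRep ζ) {P : K[X]}
    (hdeg : P.natDegree < (minpoly K ζ).natDegree) (i : ℕ) :
    ‖(P.coeff i : PadicAlgCl p)‖ ≤ ‖aeval ζ P‖ := by
  have hint : IsIntegral K ζ := (Algebra.IsIntegral.isIntegral (R := ℚ_[p]) ζ).tower_top
  set s := ((minpoly K ζ).rootSet (PadicAlgCl p)).toFinset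
  have hconj : ∀ z ∈ s, ∃ σ : Gal(PadicAlgCl p/K), σ ζ = z := fun z hz =>
    isConjRoot_iff_exists_algEquiv.1 ((isConjRoot_iff_aeval_eq_zero hint).2
      (mem_rootSet.1 (Set.mem_toFinset.1 hz)).2).symm
  have hrep : ∀ z ∈ s, IsTeichmullerRep z := fun z hz => by
    obtain ⟨σ, rfl⟩ := hconj z hz
    exact hζ.map (σ.restrictScalars ℚ_[p])
  have heval : ∀ z ∈ s, ‖(P.map (algebraMap K (PadicAlgCl p))).eval z‖ ≤ ‖aeval ζ P‖ := by
    intro z hz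
    obtain ⟨σ, rfl⟩ := hconj z hz
    rw [eval_map_algebraMap, aeval_algHom_apply]
    exact (norm_algEquiv (σ.restrictScalars ℚ_[p]) _).le
  have hcard : s.card = (minpoly K ζ).natDegree := by
    rw [Set.toFinset_card,
      card_rootSet_eq_natDegree (minpoly.irreducible hint).separable (IsAlgClosed.splits _)]
  have hle := norm_coeff_le_of_norm_eval_le (norm_nonneg _) (fun z hz => (hrep z hz).norm_le_one)
    (fun z hz w hw hzw => le_of_not_gt fun h =>
      hzw ((hrep z hz).eq_of_norm_sub_lt_one (hrep w hw) h))
    ((degree_le_natDegree.trans_lt (by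
      rw [natDegree_map, hcard]
      exact_mod_cast hdeg))) heval i
  rwa [coeff_map] at hle

theorem exists_norm_aeval_eq_norm_coeff (hζ : IsTeichmullerRep ζ) {P : K[X]}
    (hdeg : P.natDegree < (minpoly K ζ).natDegree) :
    ∃ i, ‖aeval ζ P‖ = ‖(P.coeff i : PadicAlgCl p)‖ := by
  obtain ⟨i, -, hi⟩ := IsUltrametricDist.exists_norm_finsetSum_le_of_nonempty
    Finset.nonempty_range_add_one fun i => (P.coeff i : PadicAlgCl p) * ζ ^ i
  refine ⟨i, le_antisymm ?_ (norm_coeff_le_norm_aeval hζ hdeg i)⟩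
  rw [aeval_eq_sum_range]
  calc _ ≤ ‖(P.coeff i : PadicAlgCl p) * ζ ^ i‖ := hi
    _ ≤ ‖(P.coeff i : PadicAlgCl p)‖ := by
      rw [norm_mul]
      exact mul_le_of_le_one_right (norm_nonneg _) (hζ.pow i).norm_le_one

theorem ord_mem_valueGroup_of_mem_adjoin_simple (hζ : IsTeichmullerRep ζ) {y : PadicAlgCl p}
    (hy : y ∈ K⟮ζ⟯) (hy0 : y ≠ 0) : ord y ∈ valueGroup p K := by
  have hint : IsIntegral K ζ := (Algebra.IsIntegral.isIntegral (R := ℚ_[p]) ζ).tower_top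
  obtain ⟨P, hdeg, hP⟩ := (IntermediateField.adjoin.powerBasis hint).exists_eq_aeval ⟨y, hy⟩
  have hPy : y = aeval ζ P := by
    have := congrArg (algebraMap K⟮ζ⟯ (PadicAlgCl p)) hP
    rwa [← aeval_algebraMap_apply] at this
  obtain ⟨i, hi⟩ := exists_norm_aeval_eq_norm_coeff hζ hdeg
  have hc : (P.coeff i : PadicAlgCl p) ≠ 0 := norm_ne_zero_iff.1 (by
    rw [← hi, ← hPy]
    exact norm_ne_zero_iff.2 hy0)
  rw [(ord_eq_iff hy0).2 (by rw [hPy, hi, norm_eq_rpow_neg_ord hc])]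
  exact ord_mem_valueGroup (P.coeff i).2

/-- The field obtained from `K` by adjoining all Teichmüller representatives, that is, the
composite of `K` with the maximal unramified extension of `ℚ_[p]`. -/
noncomputable def adjoinTeichmuller (K : IntermediateField ℚ_[p] (PadicAlgCl p)) :
    IntermediateField ℚ_[p] (PadicAlgCl p) :=
  (IntermediateField.adjoin K {z : PadicAlgCl p | IsTeichmullerRep z}).restrictScalars ℚ_[p]

theorem le_adjoinTeichmuller (K : IntermediateField ℚ_[p] (PadicAlgCl p)) :
    K ≤ adjoinTeichmuller K :=
  fun c hc => (IntermediateField.adjoin K {z : PadicAlgCl p | IsTeichmullerRep z}).algebraMap_mem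
    ⟨c, hc⟩

theorem teichmuller_mem_adjoinTeichmuller (a : Digit p)
    (K : IntermediateField ℚ_[p] (PadicAlgCl p)) : teichmuller a ∈ adjoinTeichmuller K :=
  IntermediateField.subset_adjoin K {z : PadicAlgCl p | IsTeichmullerRep z}
    (isTeichmullerRep_teichmuller a)

theorem valueGroup_adjoinTeichmuller (K : IntermediateField ℚ_[p] (PadicAlgCl p)) :
    valueGroup p (adjoinTeichmuller K) = valueGroup p K := by
  refine le_antisymm (fun t ht => ?_) (valueGroup_mono (le_adjoinTeichmuller K))
  obtain ⟨y, hy, hy0, rfl⟩ := exists_ord_eq_of_mem_valueGroup ht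
  obtain ⟨S, hS, hyS⟩ := IntermediateField.exists_finset_of_mem_adjoin
    (show y ∈ IntermediateField.adjoin K {z : PadicAlgCl p | IsTeichmullerRep z} from hy)
  obtain ⟨ζ, hζ, hgen⟩ := exists_isTeichmullerRep_forall_mem_pow_eq S.finite_toSet hS
  have hle : IntermediateField.adjoin K (S : Set (PadicAlgCl p)) ≤ K⟮ζ⟯ :=
    IntermediateField.adjoin_le_iff.2 fun z hz => by
      rcases hgen z hz with rfl | ⟨n, rfl⟩
      · exact zero_mem _
      · exact pow_mem (IntermediateField.mem_adjoin_simple_self K ζ) n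
  exact ord_mem_valueGroup_of_mem_adjoin_simple hζ (hle hyS) hy0

end AdjoinTeichmuller

section Tame

variable {K : IntermediateField ℚ_[p] (PadicAlgCl p)} {ω : ℚ → PadicAlgCl p}

theorem mem_of_pow_mem_of_norm_sub_one_lt {n : ℕ} (hn : ¬ p ∣ n) {v : PadicAlgCl p}
    (hv : ‖v - 1‖ < 1) (hmem : v ^ n ∈ K) : v ∈ K := by
  have hnorm : ‖v‖ = 1 := (norm_eq_of_norm_sub_lt (hv.trans_eq norm_one.symm)).trans norm_one
  have hv0 : v ≠ 0 := norm_ne_zero_iff.1 (hnorm ▸ one_ne_zero)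
  refine mem_iff_forall_algEquiv_eq.2 fun σ hσ => ?_
  have hroot : (σ v / v) ^ n = 1 := by
    rw [div_pow, ← map_pow, hσ _ hmem, div_self (pow_ne_zero n hv0)]
  have hnear : ‖σ v / v - 1‖ < 1 := by
    calc ‖σ v / v - 1‖ = ‖σ (v - 1) - (v - 1)‖ := by
          rw [map_sub, _root_.map_one, sub_sub_sub_cancel_right, ← div_self hv0, ← sub_div,
            norm_div, hnorm, div_one]
      _ ≤ max ‖σ (v - 1)‖ ‖v - 1‖ := norm_sub_le_max _ _
      _ < 1 := by rwa [norm_algEquiv, max_self]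
  exact (div_eq_one_iff_eq hv0).1 ((IsTeichmullerRep.of_pow_eq_one hn hroot).eq_of_norm_sub_lt_one
    (.of_pow_eq_one hn (one_pow n)) hnear)

theorem IsPowerSystem.mem_adjoinTeichmuller (hω : IsPowerSystem p ω) {t : ℚ} (ht : ¬ p ∣ t.den)
    (hmem : t ∈ valueGroup p K) : ω t ∈ adjoinTeichmuller K := by
  obtain ⟨y, hy, hy0, rfl⟩ := exists_ord_eq_of_mem_valueGroup hmem
  have hyL := le_adjoinTeichmuller K hy
  have haL := teichmuller_mem_adjoinTeichmuller (leadingDigit ω y) K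
  have hnear : ‖leadingTerm ω y / y - 1‖ < 1 := by
    rw [← div_self hy0, ← sub_div, norm_div, norm_sub_rev, div_lt_one (norm_pos_iff.2 hy0)]
    exact hω.norm_sub_leadingTerm_lt hy0
  have hratio : leadingTerm ω y / y ∈ adjoinTeichmuller K := by
    refine mem_of_pow_mem_of_norm_sub_one_lt ht hnear ?_
    rw [leadingTerm, div_pow, mul_pow]
    exact div_mem (mul_mem (pow_mem haL _) (hω.pow_den_mem _ _)) (pow_mem hyL _)
  have hterm : leadingTerm ω y ∈ adjoinTeichmuller K :=
    div_mul_cancel₀ (leadingTerm ω y) hy0 ▸ mul_mem hratio hyL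
  rw [← mul_div_cancel_left₀ (ω (ord y)) (teichmuller_ne_zero (hω.leadingDigit_ne_zero hy0))]
  exact div_mem hterm haL

theorem IsPowerSystem.ramificationIndex_adjoin_dvd (hω : IsPowerSystem p ω) {l : ℕ} (hl : l ≠ 0) :
    ramificationIndex p ℚ_[p]⟮ω (1 / l)⟯ ∣ l := by
  have hint : IsIntegral ℚ_[p] (ω (1 / l)) := Algebra.IsIntegral.isIntegral _
  have := IntermediateField.adjoin.finiteDimensional hint
  have hroot : aeval (ω (1 / l)) (X ^ l - C (p : ℚ_[p])) = 0 := by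
    rw [map_sub, map_pow, aeval_X, aeval_C, map_natCast, ← hω.map_nsmul, nsmul_eq_mul,
      mul_one_div_cancel (Nat.cast_ne_zero.2 hl), hω.map_one, sub_self]
  have hle : Module.finrank ℚ_[p] ℚ_[p]⟮ω (1 / l)⟯ ≤ l := by
    rw [IntermediateField.adjoin.finrank hint]
    exact (natDegree_le_of_dvd (minpoly.dvd _ _ hroot)
      (X_pow_sub_C_ne_zero (Nat.pos_of_ne_zero hl) _)).trans_eq natDegree_X_pow_sub_C
  have hdvd : l ∣ ramificationIndex p ℚ_[p]⟮ω (1 / l)⟯ := by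
    have hmem := ord_mem_valueGroup (IntermediateField.mem_adjoin_simple_self ℚ_[p] (ω (1 / l)))
    rw [hω.ord_eq, mem_valueGroup_iff_den_dvd] at hmem
    simpa [hl] using hmem
  have hfinrank := Nat.le_of_dvd Module.finrank_pos (ramificationIndex_dvd_finrank ℚ_[p]⟮ω (1 / l)⟯)
  exact ((Nat.le_of_dvd (Nat.pos_of_ne_zero (ramificationIndex_ne_zero _)) hdvd).antisymm
    (hfinrank.trans hle)).symm.dvd

end Tame

/-! ### The greedy expansion and its uniqueness -/

variable {ω : ℚ → PadicAlgCl p} {x : PadicAlgCl p}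

section Remainder

/-- What is left of `x` after the first `m` terms of its greedy expansion have been subtracted, each
term being the leading term of the preceding remainder. -/
noncomputable def remainder (ω : ℚ → PadicAlgCl p) (x : PadicAlgCl p) : ℕ → PadicAlgCl p
  | 0 => x
  | m + 1 => remainder ω x m - leadingTerm ω (remainder ω x m)

theorem leadingDigit_zero : leadingDigit ω 0 = 0 := by
  rw [leadingDigit, zero_div, ← norm_sub_teichmuller_lt_one_iff (by simp), teichmuller_zero,
    sub_zero, norm_zero]
  exact one_pos

theorem leadingTerm_zero : leadingTerm ω 0 = 0 := by
  rw [leadingTerm, leadingDigit_zero, teichmuller_zero, zero_mul]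

theorem remainder_succ_of_eq_zero {m : ℕ} (h : remainder ω x m = 0) :
    remainder ω x (m + 1) = 0 := by
  rw [remainder, h, leadingTerm_zero, sub_zero]

theorem antitone_remainder_ne_zero : Antitone fun m => remainder ω x m ≠ 0 :=
  antitone_nat_of_succ_le fun _ => mt remainder_succ_of_eq_zero

theorem IsPowerSystem.ord_remainder_lt (hω : IsPowerSystem p ω) {i j : ℕ} (hij : i < j)
    (hj : remainder ω x j ≠ 0) : ord (remainder ω x i) < ord (remainder ω x j) := by
  induction j, hij using Nat.le_induction with
  | base =>
    have hi := mt remainder_succ_of_eq_zero hj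
    exact (ord_lt_ord_iff hi hj).2 (hω.norm_sub_leadingTerm_lt hi)
  | succ j _ ih =>
    have hj' := mt remainder_succ_of_eq_zero hj
    exact (ih hj').trans ((ord_lt_ord_iff hj' hj).2 (hω.norm_sub_leadingTerm_lt hj'))

section IntermediateField

variable {L : IntermediateField ℚ_[p] (PadicAlgCl p)}

theorem remainder_mem (hpow : ∀ t ∈ valueGroup p L, ω t ∈ L) (hrep : ∀ a, teichmuller a ∈ L)
    (hx : x ∈ L) (m : ℕ) : remainder ω x m ∈ L := by
  induction m with
  | zero => exact hx
  | succ m ih => exact sub_mem ih (mul_mem (hrep _) (hpow _ (ord_mem_valueGroup ih)))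

theorem IsPowerSystem.norm_le_mul_of_norm_lt (hω : IsPowerSystem p ω) {e : ℕ}
    (hden : ∀ t ∈ valueGroup p L, t.den ∣ e) {y z : PadicAlgCl p} (hy : y ∈ L) (hz : z ∈ L)
    (h : ‖z‖ < ‖y‖) : ‖z‖ ≤ ‖ω (1 / e)‖ * ‖y‖ := by
  rcases eq_or_ne z 0 with rfl | hz0
  · rw [norm_zero]
    positivity
  have hy0 : y ≠ 0 := norm_pos_iff.1 ((norm_nonneg z).trans_lt h)
  have hgap : 1 / (e : ℚ) ≤ ord z - ord y :=
    one_div_le_of_den_dvd (sub_pos.2 ((ord_lt_ord_iff hy0 hz0).2 h))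
      (hden _ (sub_mem (ord_mem_valueGroup hz) (ord_mem_valueGroup hy)))
  rw [← hω.norm_ord hz0, ← hω.norm_ord hy0, ← norm_mul, ← hω.map_add, ← not_lt,
    hω.norm_lt_norm_iff, not_lt]
  exact le_sub_iff_add_le.1 hgap

theorem IsPowerSystem.tendsto_remainder (hω : IsPowerSystem p ω) {e : ℕ} (he : e ≠ 0)
    (hden : ∀ t ∈ valueGroup p L, t.den ∣ e) (hmem : ∀ m, remainder ω x m ∈ L) :
    Tendsto (remainder ω x) atTop (𝓝 0) := by
  have hstep (m : ℕ) : ‖remainder ω x (m + 1)‖ ≤ ‖ω (1 / e)‖ * ‖remainder ω x m‖ := by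
    by_cases h0 : remainder ω x m = 0
    · rw [remainder_succ_of_eq_zero h0, norm_zero]
      positivity
    · exact hω.norm_le_mul_of_norm_lt hden (hmem m) (hmem (m + 1)) (hω.norm_sub_leadingTerm_lt h0)
  have hlt : ‖ω (1 / e)‖ < 1 := by
    rw [← norm_one (α := PadicAlgCl p), ← hω.map_zero, hω.norm_lt_norm_iff]
    positivity
  have hgeom (m : ℕ) : ‖remainder ω x m‖ ≤ ‖ω (1 / e)‖ ^ m * ‖remainder ω x 0‖ :=
    le_geom (u := fun m => ‖remainder ω x m‖) (norm_nonneg _) m fun k _ => hstep k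
  refine squeeze_zero_norm hgeom ?_
  rw [← zero_mul ‖remainder ω x 0‖]
  exact (tendsto_pow_atTop_nhds_zero_of_lt_one (norm_nonneg _) hlt).mul_const _

end IntermediateField

end Remainder

section PartialSum

variable {N : ℕ∞} {t : ℕ → ℚ} {ε : ℕ → Digit p} {m : ℕ}

/-- The sum of the terms of index `< m` of an expansion of length `N`. -/
noncomputable def partialSum (ω : ℚ → PadicAlgCl p) (N : ℕ∞) (t : ℕ → ℚ) (ε : ℕ → Digit p)
    (m : ℕ) : PadicAlgCl p :=
  ∑ i ∈ Finset.range m with ((i : ℕ) : ℕ∞) < N, teichmuller (ε i) * ω (t i)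

theorem partialSum_succ_of_lt (hm : (m : ℕ∞) < N) :
    partialSum ω N t ε (m + 1) = partialSum ω N t ε m + teichmuller (ε m) * ω (t m) := by
  rw [partialSum, Finset.range_add_one, Finset.filter_insert, if_pos hm,
    Finset.sum_insert (by simp), add_comm, partialSum]

theorem partialSum_succ_of_le (hm : N ≤ m) :
    partialSum ω N t ε (m + 1) = partialSum ω N t ε m := by
  rw [partialSum, Finset.range_add_one, Finset.filter_insert, if_neg hm.not_gt, partialSum]

theorem partialSum_of_le {l : ℕ} (hm : N ≤ m) (hl : m ≤ l) :
    partialSum ω N t ε l = partialSum ω N t ε m := by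
  induction l, hl using Nat.le_induction with
  | base => rfl
  | succ l hl ih => rw [partialSum_succ_of_le (hm.trans (Nat.cast_le.2 hl)), ih]

theorem exists_enat_lt_iff {P : ℕ → Prop} (hP : Antitone P) :
    ∃ N : ℕ∞, ∀ m : ℕ, (m : ℕ∞) < N ↔ P m := by
  classical
  by_cases h : ∀ m, P m
  · exact ⟨⊤, fun m => ⟨fun _ => h m, fun _ => ENat.natCast_lt_top m⟩⟩
  · push Not at h
    refine ⟨Nat.find h, fun m => Nat.cast_lt.trans ⟨fun hm => ?_, fun hm => ?_⟩⟩
    · exact not_not.1 (Nat.find_min h hm)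
    · exact not_le.1 fun hle => Nat.find_spec h (hP hle hm)

theorem IsPowerSystem.exists_isExpansion_remainder (hω : IsPowerSystem p ω)
    (h : Tendsto (remainder ω x) atTop (𝓝 0)) :
    ∃ N, IsExpansion p ω x N (fun i => ord (remainder ω x i))
      fun i => leadingDigit ω (remainder ω x i) := by
  obtain ⟨N, hN⟩ := exists_enat_lt_iff (antitone_remainder_ne_zero (ω := ω) (x := x))
  refine ⟨N, fun i j hij hj => hω.ord_remainder_lt hij ((hN j).1 hj),
    fun i hi => hω.leadingDigit_ne_zero ((hN i).1 hi), ?_⟩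
  have hsum (m : ℕ) : x - remainder ω x m = partialSum ω N (fun i => ord (remainder ω x i))
      (fun i => leadingDigit ω (remainder ω x i)) m := by
    induction m with
    | zero => exact sub_self x
    | succ m ih =>
      rcases lt_or_ge (m : ℕ∞) N with hm | hm
      · rw [partialSum_succ_of_lt hm, ← ih, remainder, ← sub_add, leadingTerm]
      · have h0 : remainder ω x m = 0 := not_not.1 ((hN m).not.1 hm.not_gt)
        rw [partialSum_succ_of_le hm, ← ih, remainder_succ_of_eq_zero h0, h0]
  have hlim := (h.const_sub x).congr hsum
  rwa [sub_zero] at hlim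

namespace IsExpansion

theorem tendsto_partialSum (h : IsExpansion p ω x N t ε) :
    Tendsto (partialSum ω N t ε) atTop (𝓝 x) := h.tendsto_sum

theorem eq_partialSum_of_le (h : IsExpansion p ω x N t ε) (hm : N ≤ m) :
    x = partialSum ω N t ε m :=
  tendsto_nhds_unique h.tendsto_partialSum (tendsto_atTop_of_eventually_const fun _ hl =>
    partialSum_of_le hm hl)

theorem norm_partialSum_sub_le (h : IsExpansion p ω x N t ε) (hω : IsPowerSystem p ω) {l : ℕ}
    (hl : m ≤ l) : ‖partialSum ω N t ε l - partialSum ω N t ε m‖ ≤ ‖ω (t m)‖ := by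
  induction l, hl using Nat.le_induction with
  | base => rw [sub_self, norm_zero]; exact norm_nonneg _
  | succ l hl ih =>
    rcases lt_or_ge (l : ℕ∞) N with hlN | hlN
    · have hterm : ‖teichmuller (ε l) * ω (t l)‖ ≤ ‖ω (t m)‖ := by
        rw [norm_mul, norm_teichmuller (h.digit_ne_zero l hlN), one_mul]
        rcases hl.eq_or_lt with rfl | hlt
        · exact le_rfl
        · exact (hω.norm_lt_norm_iff.2 (h.strictMono m l hlt hlN)).le
      rw [partialSum_succ_of_lt hlN, add_sub_right_comm]
      exact (IsUltrametricDist.norm_add_le_max _ _).trans (max_le ih hterm)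
    · rwa [partialSum_succ_of_le hlN]

theorem norm_sub_partialSum_succ_lt (h : IsExpansion p ω x N t ε) (hω : IsPowerSystem p ω)
    (m : ℕ) : ‖x - partialSum ω N t ε (m + 1)‖ < ‖ω (t m)‖ := by
  rcases lt_or_ge ((m + 1 : ℕ) : ℕ∞) N with hlt | hge
  · have hle : ‖x - partialSum ω N t ε (m + 1)‖ ≤ ‖ω (t (m + 1))‖ :=
      le_of_tendsto (h.tendsto_partialSum.sub_const _).norm
        (eventually_atTop.2 ⟨m + 1, fun _ hl => h.norm_partialSum_sub_le hω hl⟩)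
    exact hle.trans_lt (hω.norm_lt_norm_iff.2 (h.strictMono m (m + 1) m.lt_succ_self hlt))
  · rw [← h.eq_partialSum_of_le hge, sub_self, norm_zero]
    exact norm_pos_iff.2 (hω.ne_zero _)

theorem ord_eq_and_leadingDigit_eq (h : IsExpansion p ω x N t ε) (hω : IsPowerSystem p ω)
    (hm : (m : ℕ∞) < N) : ord (x - partialSum ω N t ε m) = t m ∧
      leadingDigit ω (x - partialSum ω N t ε m) = ε m := by
  have hlt := h.norm_sub_partialSum_succ_lt hω m
  rw [partialSum_succ_of_lt hm, ← sub_sub] at hlt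
  exact hω.ord_eq_and_leadingDigit_eq (h.digit_ne_zero m hm) hlt

theorem sub_partialSum (h : IsExpansion p ω x N t ε) (hω : IsPowerSystem p ω) (m : ℕ) :
    x - partialSum ω N t ε m = remainder ω x m := by
  induction m with
  | zero => exact sub_zero x
  | succ m ih =>
    rcases lt_or_ge (m : ℕ∞) N with hm | hm
    · obtain ⟨hord, hdigit⟩ := h.ord_eq_and_leadingDigit_eq hω hm
      rw [partialSum_succ_of_lt hm, ← sub_sub, remainder, ← ih, leadingTerm, hord, hdigit]
    · have h0 : remainder ω x m = 0 := by rw [← ih, ← h.eq_partialSum_of_le hm, sub_self]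
      rw [partialSum_succ_of_le hm, ih, h0, remainder_succ_of_eq_zero h0]

theorem exponent_eq (h : IsExpansion p ω x N t ε) (hω : IsPowerSystem p ω) (hm : (m : ℕ∞) < N) :
    t m = ord (remainder ω x m) := by
  rw [← h.sub_partialSum hω, (h.ord_eq_and_leadingDigit_eq hω hm).1]

theorem digit_eq (h : IsExpansion p ω x N t ε) (hω : IsPowerSystem p ω) (hm : (m : ℕ∞) < N) :
    ε m = leadingDigit ω (remainder ω x m) := by
  rw [← h.sub_partialSum hω, (h.ord_eq_and_leadingDigit_eq hω hm).2]

theorem lt_iff_remainder_ne_zero (h : IsExpansion p ω x N t ε) (hω : IsPowerSystem p ω) :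
    (m : ℕ∞) < N ↔ remainder ω x m ≠ 0 := by
  constructor
  · rintro hm h0
    refine h.digit_ne_zero m hm ?_
    rw [h.digit_eq hω hm, h0, leadingDigit_zero]
  · contrapose!
    intro hm
    rw [← h.sub_partialSum hω, ← h.eq_partialSum_of_le hm, sub_self]

theorem unique (h : IsExpansion p ω x N t ε) (hω : IsPowerSystem p ω) {N' : ℕ∞} {t' : ℕ → ℚ}
    {ε' : ℕ → Digit p} (h' : IsExpansion p ω x N' t' ε') :
    N' = N ∧ ∀ i : ℕ, (i : ℕ∞) < N → t' i = t i ∧ ε' i = ε i := by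
  have hlt (m : ℕ) : (m : ℕ∞) < N' ↔ (m : ℕ∞) < N := by
    rw [h'.lt_iff_remainder_ne_zero hω, h.lt_iff_remainder_ne_zero hω]
  have hN : N' = N := ENat.eq_of_forall_natCast_le_iff fun m => by
    cases m with
    | zero => simp
    | succ m => rw [Nat.cast_succ, ENat.natCast_add_one_le_iff, ENat.natCast_add_one_le_iff, hlt m]
  refine ⟨hN, fun i hi => ⟨?_, ?_⟩⟩
  · rw [h.exponent_eq hω hi, h'.exponent_eq hω ((hlt i).2 hi)]
  · rw [h.digit_eq hω hi, h'.digit_eq hω ((hlt i).2 hi)]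

end IsExpansion

end PartialSum

/-! ### Expansions of elements of tamely ramified extensions -/

theorem IsPowerSystem.exists_isExpansion (hω : IsPowerSystem p ω)
    {K : IntermediateField ℚ_[p] (PadicAlgCl p)} [FiniteDimensional ℚ_[p] K]
    (he : ¬ p ∣ ramificationIndex p K) (hx : x ∈ K) :
    ∃ N t ε, IsExpansion p ω x N t ε ∧
      ∀ i : ℕ, (i : ℕ∞) < N → (t i).den ∣ ramificationIndex p K := by
  have hden : ∀ t ∈ valueGroup p (adjoinTeichmuller K), t.den ∣ ramificationIndex p K := fun t ht =>
    mem_valueGroup_iff_den_dvd.1 (valueGroup_adjoinTeichmuller K ▸ ht)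
  have hpow : ∀ t ∈ valueGroup p (adjoinTeichmuller K), ω t ∈ adjoinTeichmuller K := fun t ht =>
    hω.mem_adjoinTeichmuller (mt (fun hp => hp.trans (hden t ht)) he)
      (valueGroup_adjoinTeichmuller K ▸ ht)
  have hmem : ∀ m, remainder ω x m ∈ adjoinTeichmuller K :=
    remainder_mem hpow (fun a => teichmuller_mem_adjoinTeichmuller a K) (le_adjoinTeichmuller K hx)
  obtain ⟨N, h⟩ := hω.exists_isExpansion_remainder
    (hω.tendsto_remainder (ramificationIndex_ne_zero K) hden hmem)
  exact ⟨N, _, _, h, fun i _ => hden _ (ord_mem_valueGroup (hmem i))⟩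

theorem IsPowerSystem.algEquiv_div_pow_den (hω : IsPowerSystem p ω)
    (σ : Gal(PadicAlgCl p/ℚ_[p])) (t : ℚ) : (σ (ω t) / ω t) ^ t.den = 1 := by
  rw [div_pow, ← map_pow, hω.pow_den, map_zpow₀, map_natCast, ← hω.pow_den,
    div_self (pow_ne_zero _ (hω.ne_zero t))]

namespace IsExpansion

variable {N : ℕ∞} {t : ℕ → ℚ} {ε : ℕ → Digit p}

theorem map_algEquiv (h : IsExpansion p ω x N t ε) (hω : IsPowerSystem p ω)
    (σ : Gal(PadicAlgCl p/ℚ_[p])) {ε' : ℕ → Digit p}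
    (hε' : ∀ i : ℕ, (i : ℕ∞) < N →
      teichmuller (ε' i) = σ (teichmuller (ε i)) * (σ (ω (t i)) / ω (t i))) :
    IsExpansion p ω (σ x) N t ε' where
  strictMono := h.strictMono
  digit_ne_zero i hi h0 := by
    have hσ : σ (teichmuller (ε i)) * (σ (ω (t i)) / ω (t i)) = 0 := by
      rw [← hε' i hi, h0, teichmuller_zero]
    simp [teichmuller_ne_zero (h.digit_ne_zero i hi), hω.ne_zero] at hσ
  tendsto_sum := by
    refine (((continuous_algEquiv σ).tendsto x).comp h.tendsto_sum).congr fun m => ?_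
    rw [Function.comp_apply, map_sum]
    refine Finset.sum_congr rfl fun i hi => ?_
    rw [hε' i (Finset.mem_filter.1 hi).2, mul_assoc, div_mul_cancel₀ _ (hω.ne_zero _), map_mul]

theorem teichmuller_pow_den_mem (h : IsExpansion p ω x N t ε) (hω : IsPowerSystem p ω)
    (hden : ∀ i : ℕ, (i : ℕ∞) < N → ¬ p ∣ (t i).den) {i : ℕ} (hi : (i : ℕ∞) < N) :
    teichmuller (ε i) ^ (t i).den ∈ ℚ_[p]⟮x⟯ := by
  refine mem_iff_forall_algEquiv_eq.2 fun σ hσ => ?_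
  have hε' (j : ℕ) (hj : (j : ℕ∞) < N) :
      teichmuller (reduction (σ (teichmuller (ε j)) * (σ (ω (t j)) / ω (t j)))) =
        σ (teichmuller (ε j)) * (σ (ω (t j)) / ω (t j)) :=
    (((isTeichmullerRep_teichmuller _).map σ).mul
      (.of_pow_eq_one (hden j hj) (hω.algEquiv_div_pow_den σ _))).teichmuller_reduction
  have hmap := h.map_algEquiv hω σ hε'
  rw [hσ x (IntermediateField.mem_adjoin_simple_self ℚ_[p] x)] at hmap
  have hdigit := ((h.unique hω hmap).2 i hi).2
  calc σ (teichmuller (ε i) ^ (t i).den)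
      = (σ (teichmuller (ε i)) * (σ (ω (t i)) / ω (t i))) ^ (t i).den := by
        rw [mul_pow, hω.algEquiv_div_pow_den, mul_one, map_pow]
    _ = teichmuller (ε i) ^ (t i).den := by rw [← hε' i hi, hdigit]

theorem mem_of_forall_mem (h : IsExpansion p ω x N t ε)
    {L : IntermediateField ℚ_[p] (PadicAlgCl p)} (hrep : ∀ a, teichmuller a ∈ L)
    (hpow : ∀ i : ℕ, (i : ℕ∞) < N → ω (t i) ∈ L) : x ∈ L :=
  (isClosed_intermediateField L).mem_of_tendsto h.tendsto_sum <| .of_forall fun _ =>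
    sum_mem fun i hi => mul_mem (hrep _) (hpow i (Finset.mem_filter.1 hi).2)

theorem ramificationIndex_dvd (h : IsExpansion p ω x N t ε) (hω : IsPowerSystem p ω) {l : ℕ}
    (hl : ∀ i : ℕ, (i : ℕ∞) < N → (t i).den ∣ l) : ramificationIndex p ℚ_[p]⟮x⟯ ∣ l := by
  rcases eq_or_ne l 0 with rfl | hl0
  · exact dvd_zero _
  set K := ℚ_[p]⟮ω (1 / l)⟯
  have : FiniteDimensional ℚ_[p] ℚ_[p]⟮x⟯ :=
    IntermediateField.adjoin.finiteDimensional (Algebra.IsIntegral.isIntegral x)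
  have : FiniteDimensional ℚ_[p] K :=
    IntermediateField.adjoin.finiteDimensional (Algebra.IsIntegral.isIntegral _)
  have hx : x ∈ adjoinTeichmuller K :=
    h.mem_of_forall_mem (fun a => teichmuller_mem_adjoinTeichmuller a K) fun i hi =>
      le_adjoinTeichmuller K (hω.mem_adjoin_of_den_dvd hl0 (hl i hi))
  have hle : valueGroup p ℚ_[p]⟮x⟯ ≤ valueGroup p K :=
    valueGroup_adjoinTeichmuller K ▸ valueGroup_mono (IntermediateField.adjoin_simple_le_iff.2 hx)
  exact ramificationIndex_dvd_iff.2 fun t ht =>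
    (mem_valueGroup_iff_den_dvd.1 (hle ht)).trans (hω.ramificationIndex_adjoin_dvd hl0)

end IsExpansion

theorem exists_finite_subfield_of_teichmuller_pow_mem
    (K : IntermediateField ℚ_[p] (PadicAlgCl p)) [FiniteDimensional ℚ_[p] K] {e : ℕ} (he : e ≠ 0) :
    ∃ k : Subfield (Digit p), Finite k ∧
      ∀ (a : Digit p) (n : ℕ), n ∣ e → teichmuller a ^ n ∈ K → a ∈ k := by
  obtain ⟨k, hk, hsub⟩ := exists_finite_subfield_digit (finite_setOf_teichmuller_pow_mem K he)
  refine ⟨k, hk, fun a n hn ha => hsub ?_⟩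
  obtain ⟨c, rfl⟩ := hn
  rw [Set.mem_ofPred_eq, pow_mul]
  exact pow_mem ha c

theorem ramificationIndex_dvd_natDegree_minpoly (x : PadicAlgCl p) :
    ramificationIndex p ℚ_[p]⟮x⟯ ∣ (minpoly ℚ_[p] x).natDegree := by
  have hint : IsIntegral ℚ_[p] x := Algebra.IsIntegral.isIntegral x
  have := IntermediateField.adjoin.finiteDimensional hint
  exact IntermediateField.adjoin.finrank hint ▸ ramificationIndex_dvd_finrank ℚ_[p]⟮x⟯

end PadicExpansion

open PadicExpansion in
theorem theorem6p1_general (p : ℕ) [Fact p.Prime]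
    (ω : ℚ → PadicAlgCl p) (hω : PadicExpansion.IsPowerSystem p ω)
    (x : PadicAlgCl p) (hram : ¬ p ∣ PadicExpansion.ramificationIndex p ℚ_[p]⟮x⟯) :
    ∃ (N : ℕ∞) (t : ℕ → ℚ) (ε : ℕ → PadicExpansion.Digit p),
      PadicExpansion.IsExpansion p ω x N t ε ∧
      Tendsto (fun m : ℕ => {i ∈ Finset.range m | ((i : ℕ) : ℕ∞) < N}.lcm fun i => (t i).den) atTop
        (𝓝 (PadicExpansion.ramificationIndex p ℚ_[p]⟮x⟯)) ∧
      (∀ i : ℕ, (i : ℕ∞) < N → PadicExpansion.teichmuller (ε i) ^ (t i).den ∈ ℚ_[p]⟮x⟯) ∧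
      (∃ k : Subfield (PadicExpansion.Digit p), Finite k ∧ ∀ i : ℕ, (i : ℕ∞) < N → ε i ∈ k) ∧
      (∀ (N' : ℕ∞) (t' : ℕ → ℚ) (ε' : ℕ → PadicExpansion.Digit p),
        PadicExpansion.IsExpansion p ω x N' t' ε' →
          N' = N ∧ ∀ i : ℕ, (i : ℕ∞) < N → t' i = t i ∧ ε' i = ε i) := by
  have : FiniteDimensional ℚ_[p] ℚ_[p]⟮x⟯ :=
    IntermediateField.adjoin.finiteDimensional (Algebra.IsIntegral.isIntegral x)
  have he := ramificationIndex_ne_zero ℚ_[p]⟮x⟯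
  obtain ⟨N, t, ε, h, hden⟩ :=
    hω.exists_isExpansion hram (IntermediateField.mem_adjoin_simple_self ℚ_[p] x)
  have hmem (i : ℕ) (hi : (i : ℕ∞) < N) : teichmuller (ε i) ^ (t i).den ∈ ℚ_[p]⟮x⟯ :=
    h.teichmuller_pow_den_mem hω (fun j hj => mt (fun hp => hp.trans (hden j hj)) hram) hi
  obtain ⟨k, hk, hdigit⟩ := exists_finite_subfield_of_teichmuller_pow_mem ℚ_[p]⟮x⟯ he
  exact ⟨N, t, ε, h,
    tendsto_lcm_filter_range he hden fun l hl => h.ramificationIndex_dvd hω hl, hmem,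
    ⟨k, hk, fun i hi => hdigit _ _ (hden i hi) (hmem i hi)⟩, fun N' t' ε' h' => h.unique hω h'⟩

theorem theorem6p1 (p : ℕ) [Fact p.Prime]
    (ω : ℚ → PadicAlgCl p) (hω : PadicExpansion.IsPowerSystem p ω)
    (x : PadicAlgCl p) (hx : Valued.v x ≤ 1) (hn : ¬ p ∣ (minpoly ℚ_[p] x).natDegree) :
    ∃ (N : ℕ∞) (t : ℕ → ℚ) (ε : ℕ → PadicExpansion.Digit p),
      PadicExpansion.IsExpansion p ω x N t ε ∧
      Tendsto (fun m : ℕ => {i ∈ Finset.range m | ((i : ℕ) : ℕ∞) < N}.lcm fun i => (t i).den) atTop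
        (𝓝 (PadicExpansion.ramificationIndex p ℚ_[p]⟮x⟯)) ∧
      (∀ i : ℕ, (i : ℕ∞) < N → PadicExpansion.teichmuller (ε i) ^ (t i).den ∈ ℚ_[p]⟮x⟯) ∧
      (∃ k : Subfield (PadicExpansion.Digit p), Finite k ∧ ∀ i : ℕ, (i : ℕ∞) < N → ε i ∈ k) ∧
      (∀ (N' : ℕ∞) (t' : ℕ → ℚ) (ε' : ℕ → PadicExpansion.Digit p),
        PadicExpansion.IsExpansion p ω x N' t' ε' →
          N' = N ∧ ∀ i : ℕ, (i : ℕ∞) < N → t' i = t i ∧ ε' i = ε i) :=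
  theorem6p1_general p ω hω x fun h => hn
    (h.trans (PadicExpansion.ramificationIndex_dvd_natDegree_minpoly x))
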